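/- Let $\alpha>-1/2$ and $\beta\in\mathbb R$, and let $$w(z)=C\,(1-z)^{\alpha+i\beta}(1-1/z)^{\alpha-i\beta},\qquad |z|=1,$$ be the normalised pure Fisher–Hartwig weight, where the branches of the powers are those equal to $1$ at $z=0$ and at $z=\infty$ respectively, and $C$ is the constant for which $w_0:=\int_{|z|=1}\frac{w(z)}{z}\frac{dz}{2\pi i}=\frac1{2\pi}$. Then $w$ is integrable on the unit circle, and there is exactly one system of polynomials $\phi_n(z)=k_nz^n+l_nz^{n-1}+\dots+\phi_n(0)$, $k_n>0$, $n\ge 0$, with $$\int_{|z|=1}\phi_m(z)\overline{\phi_n(z)}\,w(z)\frac{dz}{iz}=\delta_{m,n}.$$ Put $k_{-1}=0$, $m_n=k_n/k_{n+1}$ for $n\ge -1$, and $r_n=\phi_n(0)/k_n$ for $n\ge 0$. Then $k_0=1$, and for all $n\ge 0$ (unless indicated otherwise) $$2\alpha+2n+1=m_n^2(\alpha+i\beta+n+1)(\alpha-i\beta+n+1)-m_{n-1}^2(\alpha+i\beta+n)(\alpha-i\beta+n),$$ $$m_n^2=\frac{(n+1)(2\alpha+n+1)}{(\alpha+i\beta+n+1)(\alpha-i\beta+n+1)},$$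 $$k_n^2=\frac{\Gamma(2\alpha+1)}{\Gamma(\alpha-i\beta+1)\Gamma(\alpha+i\beta+1)}\,\frac{\Gamma(\alpha+i\beta+n+1)}{\Gamma(n+1)}\,\frac{\Gamma(\alpha-i\beta+n+1)}{\Gamma(n+2\alpha+1)},$$ $$|\phi_n(0)|^2=\frac{\Gamma(2\alpha+1)}{\Gamma(n+1)\Gamma(n+2\alpha+1)}\,\frac{|\Gamma(\alpha+i\beta+n)|^2}{|\Gamma(\alpha+i\beta)|^2}\qquad\text{if }(\alpha,\beta)\ne(0,0),$$ while $\phi_n(0)=0$ for $n\ge1$ if $\alpha=\beta=0$; $$l_n=\frac{(\alpha-i\beta)\,n}{n+\alpha+i\beta}\,k_n\qquad(n\ge 1),$$ $$(\alpha+i\beta+n+1)\,r_{n+1}=(n+\alpha-i\beta)\,r_n,$$ so that, if $(\alpha,\beta)\neq(0,0)$, $r_n\ne0$ and $\dfrac{r_{n+1}}{r_n}=\dfrac{n+\alpha-i\beta}{\alpha+i\beta+n+1}$. Finally, with $\pi^*(z)=\sum_{j=0}^n\overline{a_j}z^{n-j}$ for $\pi(z)=\sum_{j=0}^na_jz^j$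 (and $\phi_n^*$ formed with degree $n$), $$I_n:=\int_{|\xi|=1}\phi_n(\xi)\overline{\phi_n^*(\xi)}\,\frac{w(\xi)}{i\xi}\,d\xi=r_n,$$ and, if $\alpha>0$, the integrand of the following integral is integrable and $$J_n:=\int_{|\xi|=1}\frac{\phi_n(\xi)\overline{\phi_n^*(\xi)}}{1-\xi}\,\frac{w(\xi)}{i\xi}\,d\xi=\frac{(\alpha+i\beta-n)\,r_n}{2\alpha}.$$ -/

import Mathlib

open scoped ComplexConjugate

noncomputable section

namespace FisherHartwig

open Complex Polynomial

/-- The exponent `α + iβ` of the factor `1 - z`. -/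
def expA (α β : ℝ) : ℂ := (α : ℂ) + I * (β : ℂ)

/-- The exponent `α - iβ` of the factor `1 - 1/z`. -/
def expB (α β : ℝ) : ℂ := (α : ℂ) - I * (β : ℂ)

/-- The pure Fisher-Hartwig symbol `(1 - z)^(α + iβ) (1 - 1/z)^(α - iβ)` on `|z| = 1`.
The powers are principal: `1 - z` and `1 - 1/z` have positive real part for `|z| < 1` and
`|z| > 1` respectively, so these are the branches equal to one at `z = 0` and at `z = ∞`. -/
def pureSymbol (α β : ℝ) (z : ℂ) : ℂ :=
  (1 - z) ^ expA α β * (1 - 1 / z) ^ expB α β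

/-- The Fourier (Toeplitz) coefficient `w_j = ∫_{|z| = 1} w(z) / z^(j+1) dz / (2πi)`. -/
def symbolCoeff (w : ℂ → ℂ) (j : ℤ) : ℂ :=
  (2 * (Real.pi : ℂ) * I)⁻¹ * ∮ z in C(0, 1), w z / z ^ (j + 1)

/-- The normalisation constant `C`, for which `C` times the symbol has `w_0 = 1 / (2π)`. -/
def normConst (α β : ℝ) : ℂ :=
  (2 * (Real.pi : ℂ) * symbolCoeff (pureSymbol α β) 0)⁻¹

/-- The normalised pure Fisher-Hartwig weight. -/
def weight (α β : ℝ) (z : ℂ) : ℂ := normConst α β * pureSymbol α β z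

/-- `φ_0, φ_1, …` are the orthonormal polynomials on the unit circle for `w`: `φ_n` has degree `n`
and positive leading coefficient, and
`∫_{|z| = 1} φ_m(z) conj(φ_n(z)) w(z) dz / (iz) = δ_{m,n}`. -/
structure IsOrthonormalSystem (w : ℂ → ℂ) (φ : ℕ → ℂ[X]) : Prop where
  natDegree_eq : ∀ n, (φ n).natDegree = n
  leading_pos : ∀ n, ((φ n).coeff n).im = 0 ∧ 0 < ((φ n).coeff n).re
  orthonormal : ∀ m n,
    (∮ z in C(0, 1), (φ m).eval z * conj ((φ n).eval z) * w z / (I * z)) = if m = n then 1 else 0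

/-- The leading coefficient `k_n`, a real number, with the convention `k_n = 0` for `n < 0`. -/
def kCoeff (φ : ℕ → ℂ[X]) : ℤ → ℝ
  | Int.ofNat n => ((φ n).coeff n).re
  | Int.negSucc _ => 0

/-- The coefficient `l_n` of `z^(n-1)` in `φ_n`, for `n ≥ 1`. -/
def lCoeff (φ : ℕ → ℂ[X]) (n : ℕ) : ℂ := (φ n).coeff (n - 1)

/-- `m_n = k_n / k_{n+1}`, for `n ≥ -1`. -/
def mRatio (φ : ℕ → ℂ[X]) (n : ℤ) : ℝ := kCoeff φ n / kCoeff φ (n + 1)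

/-- `r_n = φ_n(0) / k_n`. -/
def rRatio (φ : ℕ → ℂ[X]) (n : ℕ) : ℂ := (φ n).eval 0 / (kCoeff φ n : ℂ)

/-- For `p = ∑_{j ≤ n} a_j z^j`, the polynomial `p^* = ∑_{j ≤ n} conj(a_j) z^(n-j)`. -/
def starPoly (n : ℕ) (p : ℂ[X]) : ℂ[X] :=
  ∑ j ∈ Finset.range (n + 1), Polynomial.C (conj (p.coeff j)) * X ^ (n - j)

/-- The integrand `φ_n(ξ) conj(φ_n^*(ξ)) w(ξ) / (iξ)` of `I_n`. -/
def integrandI (w : ℂ → ℂ) (φ : ℕ → ℂ[X]) (n : ℕ) (ξ : ℂ) : ℂ :=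
  (φ n).eval ξ * conj ((starPoly n (φ n)).eval ξ) * (w ξ / (I * ξ))

/-- The integrand `φ_n(ξ) conj(φ_n^*(ξ)) / (1 - ξ) · w(ξ) / (iξ)` of `J_n`. -/
def integrandJ (w : ℂ → ℂ) (φ : ℕ → ℂ[X]) (n : ℕ) (ξ : ℂ) : ℂ :=
  (φ n).eval ξ * conj ((starPoly n (φ n)).eval ξ) / (1 - ξ) * (w ξ / (I * ξ))

end FisherHartwig

end

/-! Write `a = expA α β`, `b = expB α β`. On `z = e^{iθ}`, `0 < θ < 2π`, the symbol equals `e^{πβ}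
(2 sin(θ/2))^{2α} e^{-βθ}`, so the weight is real and integrable. Integrating the derivative of `(2
sin(θ/2))^s e^{cθ}` with `s = 2α + 1` yields a two-term recurrence for the moments `M_k = ∫ z^k w
dθ`: `(k + 1 + a) M_{k+1} = (k - b) M_k` (`moment_recurrence`). Everything up to `I_n` follows
algebraically from this, `M_0 = 1` and `M_{-k} = conj M_k`.

The monic orthogonal polynomial is hypergeometric, with coefficients `binom(n,j) (b)_{n-j} (a+1)_j /
(a+1)_n`. A Pascal rule for these coefficients, combined with the moment recurrence, expresses the
pairings at level `n + 1` with `z^k` through those at level `n` (`jacobiPairing_succ`).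
Orthogonality follows by induction, and a ratio identity between neighbouring pairings gives the
norms (`jacobiPairing_diag_succ`). Positivity of the norms gives existence and uniqueness, so every
formula for `k_n`, `l_n`, `r_n` is read off explicit coefficients.

On the circle `conj φ_n^* = z^{-n} φ_n`. In `I_n` orthogonality leaves only the top coefficient of
`φ_n^*`. For `J_n`, a second integration by parts gives `2α ∫ z^k w/(1-z) dθ = (k + a) M_k`, so
dividing by `1 - z` acts as the operator `z d/dz + a`; orthogonality then leaves only a multiple of
`φ_n(0)`. -/

noncomputable section

namespace FisherHartwig

open Complex Polynomial

/-! ### Hypergeometric coefficients and their pairings with an abstract moment sequence. -/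

/-- The coefficient of `z^j` in `(a + 1)_n` times the monic orthogonal polynomial of degree `n`. -/
def jacobiCoeff (a b : ℂ) (n j : ℕ) : ℂ :=
  (n.choose j : ℂ) * (ascPochhammer ℂ (n - j)).eval b * (ascPochhammer ℂ j).eval (a + 1)

theorem jacobiCoeff_succ_zero (a b : ℂ) (n : ℕ) :
    jacobiCoeff a b (n + 1) 0 = (b + n) * jacobiCoeff a b n 0 := by
  simp [jacobiCoeff, ascPochhammer_succ_eval, mul_comm]

theorem jacobiCoeff_of_lt (a b : ℂ) {n j : ℕ} (h : n < j) : jacobiCoeff a b n j = 0 := by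
  simp [jacobiCoeff, Nat.choose_eq_zero_of_lt h]

theorem jacobiCoeff_self (a b : ℂ) (n : ℕ) :
    jacobiCoeff a b n n = (ascPochhammer ℂ n).eval (a + 1) := by
  simp [jacobiCoeff]

/-- Pascal's rule splits the binomial; the last factor of `(b)_{n-j}` is peeled off in one term and
that of `(a+1)_{j+1}` in the other. -/
theorem jacobiCoeff_succ_succ (a b : ℂ) (n j : ℕ) :
    jacobiCoeff a b (n + 1) (j + 1) =
      (b + n - (j + 1)) * jacobiCoeff a b n (j + 1) + (a + j + 1) * jacobiCoeff a b n j := by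
  rcases lt_or_ge j n with h | h
  · obtain ⟨m, rfl⟩ := Nat.exists_eq_add_of_lt h
    have e1 : j + m + 1 + 1 - (j + 1) = m + 1 := by omega
    have e2 : j + m + 1 - (j + 1) = m := by omega
    have e3 : j + m + 1 - j = m + 1 := by omega
    simp only [jacobiCoeff, e1, e2, e3, Nat.choose_succ_succ (j + m + 1) j,
      ascPochhammer_succ_eval]
    push_cast
    ring
  · rw [jacobiCoeff_of_lt a b (show n < j + 1 by omega)]
    rcases h.eq_or_lt with h | h
    · subst h
      rw [jacobiCoeff_self, jacobiCoeff_self, ascPochhammer_succ_eval]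
      ring
    · rw [jacobiCoeff_of_lt a b h, jacobiCoeff_of_lt a b (show n + 1 < j + 1 by omega)]
      ring

/-- Summation by parts: the step in `n` is transferred from the coefficients to the test sequence
`f`, later a shifted moment sequence. -/
theorem sum_jacobiCoeff_succ (a b : ℂ) (n : ℕ) (f : ℕ → ℂ) :
    ∑ j ∈ Finset.range (n + 2), jacobiCoeff a b (n + 1) j * f j =
      ∑ j ∈ Finset.range (n + 1), jacobiCoeff a b n j *
        ((b + n - j) * f j + (a + j + 1) * f (j + 1)) := by
  have h := Finset.sum_range_succ' (fun j : ℕ => jacobiCoeff a b n j * ((b + n - j) * f j)) (n + 1)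
  rw [Finset.sum_range_succ, jacobiCoeff_of_lt a b (Nat.lt_succ_self n), zero_mul, add_zero] at h
  simp only [mul_add (jacobiCoeff a b n _)]
  rw [Finset.sum_add_distrib, h, Finset.sum_range_succ', jacobiCoeff_succ_zero, add_right_comm,
    ← Finset.sum_add_distrib, Nat.cast_zero, sub_zero]
  congr 1
  · refine Finset.sum_congr rfl fun j _ => ?_
    rw [jacobiCoeff_succ_succ]
    push_cast
    ring
  · ring

/-- The pairing of the polynomial with coefficients `jacobiCoeff a b n` with `z^k`, for a
weight with moments `M`. -/
def jacobiPairing (a b : ℂ) (M : ℤ → ℂ) (n : ℕ) (k : ℤ) : ℂ :=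
  ∑ j ∈ Finset.range (n + 1), jacobiCoeff a b n j * M (j - k)

section Pairing

variable {a b : ℂ} {M : ℤ → ℂ}

/-- The moment recurrence at index `j - k` removes the `j`-dependent factors produced by
`sum_jacobiCoeff_succ`, leaving factors in `n` and `k` only. -/
theorem jacobiPairing_succ (hM : ∀ k : ℤ, (k + 1 + a) * M (k + 1) = (k - b) * M k)
    (n : ℕ) (k : ℤ) :
    jacobiPairing a b M (n + 1) k =
      (n - k) * jacobiPairing a b M n k + k * jacobiPairing a b M n (k - 1) := by
  unfold jacobiPairing
  rw [sum_jacobiCoeff_succ a b n fun j => M (j - k), Finset.mul_sum, Finset.mul_sum,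
    ← Finset.sum_add_distrib]
  refine Finset.sum_congr rfl fun j _ => ?_
  have h := hM (j - k)
  have e1 : ((j + 1 : ℕ) : ℤ) - k = (j : ℤ) - k + 1 := by push_cast; ring
  have e2 : (j : ℤ) - (k - 1) = (j : ℤ) - k + 1 := by ring
  rw [e1, e2]
  push_cast at h
  linear_combination jacobiCoeff a b n j * h

/-- In `jacobiPairing_succ` the two pairings not covered by induction, at `k = n` and at `k - 1 =
-1`, carry the vanishing factors `n - k` and `k`. -/
theorem jacobiPairing_eq_zero (hM : ∀ k : ℤ, (k + 1 + a) * M (k + 1) = (k - b) * M k)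
    (n : ℕ) : ∀ k : ℤ, 0 ≤ k → k < n → jacobiPairing a b M n k = 0 := by
  induction n with
  | zero => intro k h0 h1; simp at h1; omega
  | succ n ih =>
    intro k h0 h1
    rw [jacobiPairing_succ hM]
    have h2 : ((n : ℂ) - k) * jacobiPairing a b M n k = 0 := by
      rcases eq_or_ne k n with h | h
      · subst h; simp
      · rw [ih k h0 (by push_cast at h1; omega), mul_zero]
    have h3 : (k : ℂ) * jacobiPairing a b M n (k - 1) = 0 := by
      rcases eq_or_ne k 0 with h | h
      · subst h; simp
      · rw [ih (k - 1) (by omega) (by push_cast at h1; omega), mul_zero]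
    rw [h2, h3, add_zero]

theorem jacobiPairing_succ_succ_aux {n : ℕ} {k : ℂ} {s t u : ℂ}
    (h : (k + 1 - n) * (k + 1 + b) * s = (k + 1) * (k - n - a) * t)
    (hu : u = (n - (k + 1)) * s + (k + 1) * t) :
    (k + 1 + b) * u = (k + 1) * (a + b + n + 1) * t := by
  rw [hu]
  linear_combination -h

/-- For `n = 0` this is the moment recurrence at `-k - 1`. The statement makes `jacobiPairing_succ`
collapse to a single term, which links levels `n` and `n + 1` and propagates the identity. -/
theorem jacobiPairing_ratio (hM : ∀ k : ℤ, (k + 1 + a) * M (k + 1) = (k - b) * M k)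
    (hb : ∀ k : ℕ, (k : ℂ) + 1 + b ≠ 0) (n : ℕ) : ∀ k : ℕ,
    ((k : ℂ) + 1 - n) * (k + 1 + b) * jacobiPairing a b M n (k + 1) =
      (k + 1) * (k - n - a) * jacobiPairing a b M n k := by
  induction n with
  | zero =>
    intro k
    have h := hM (-k - 1)
    have e1 : (-(k : ℤ) - 1 + 1) = -k := by ring
    have e2 : (-((k : ℤ) + 1)) = -k - 1 := by ring
    simp only [jacobiPairing, zero_add, Finset.sum_range_one, jacobiCoeff_self,
      ascPochhammer_zero, eval_one, one_mul, Nat.cast_zero, zero_sub, e2, sub_zero]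
    rw [e1] at h
    push_cast at h
    linear_combination ((k : ℂ) + 1) * h
  | succ n ih =>
    have key : ∀ k : ℕ, ((k : ℂ) + 1 + b) * jacobiPairing a b M (n + 1) (k + 1) =
        (k + 1) * (a + b + n + 1) * jacobiPairing a b M n k := fun k => by
      refine jacobiPairing_succ_succ_aux (ih k) ?_
      rw [jacobiPairing_succ hM, add_sub_cancel_right]
      push_cast
      ring
    intro k
    rcases k with _ | k
    · have h0 := jacobiPairing_eq_zero hM (n + 1) 0 le_rfl (by push_cast; omega)
      rw [Nat.cast_zero (R := ℤ), h0, mul_zero]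
      -- At `k = 0` the right side vanishes by orthogonality; the left does so by its factor `k + 1
      -- - n` at level one, and by orthogonality to `z` at higher levels.
      rcases n with _ | n
      · simp
      · have h1 := jacobiPairing_eq_zero hM (n + 1 + 1) 1 (by norm_num) (by push_cast; omega)
        rw [zero_add, h1, mul_zero]
    · refine mul_left_cancel₀ (hb k) ?_
      have h1 := key k
      have h2 := key (k + 1)
      have h3 := ih k
      push_cast at h1 h2 h3 ⊢
      linear_combination ((k : ℂ) + 1 + b) * (k - n + 1) * h2 -
        ((k : ℂ) + 1 + 1) * (k - n - 1 - a + 1) * h1 +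
        ((k : ℂ) + 1 + 1) * (a + b + n + 1) * h3

theorem jacobiPairing_diag_succ (hM : ∀ k : ℤ, (k + 1 + a) * M (k + 1) = (k - b) * M k)
    (hb : ∀ k : ℕ, (k : ℂ) + 1 + b ≠ 0) (n : ℕ) :
    ((n : ℂ) + 1 + b) * jacobiPairing a b M (n + 1) (n + 1 : ℕ) =
      (n + 1) * (a + b + n + 1) * jacobiPairing a b M n n := by
  refine jacobiPairing_succ_succ_aux (jacobiPairing_ratio hM hb n n) ?_
  rw [jacobiPairing_succ hM]
  push_cast
  rw [add_sub_cancel_right]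

end Pairing

/-! ### Integrals of `(2 sin(θ/2))^s e^{cθ}`. -/

theorem sin_half_pos {θ : ℝ} (h : θ ∈ Set.Ioo 0 (2 * Real.pi)) : 0 < Real.sin (θ / 2) :=
  Real.sin_pos_of_pos_of_lt_pi (by linarith [h.1]) (by linarith [h.2])

theorem intervalIntegrable_sin_half_rpow {s : ℝ} (hs : -1 < s) :
    IntervalIntegrable (fun θ : ℝ => (2 * Real.sin (θ / 2)) ^ s) MeasureTheory.volume
      0 (2 * Real.pi) := by
  have hπ := Real.pi_pos
  have hmeas : Measurable fun θ : ℝ => (2 * Real.sin (θ / 2)) ^ s := by fun_prop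
  rcases le_or_gt 0 s with h | h
  · refine Continuous.intervalIntegrable ?_ _ _
    exact (by fun_prop : Continuous fun θ : ℝ => 2 * Real.sin (θ / 2)).rpow_const
      fun _ => Or.inr h
  · have left : IntervalIntegrable (fun θ : ℝ => (2 * Real.sin (θ / 2)) ^ s) MeasureTheory.volume
        0 Real.pi := by
      have h0 : IntervalIntegrable (fun θ : ℝ => (2 / Real.pi) ^ s * θ ^ s) MeasureTheory.volume
          0 Real.pi := (intervalIntegral.intervalIntegrable_rpow' hs).const_mul _
      refine h0.mono_fun hmeas.aestronglyMeasurable ?_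
      refine (MeasureTheory.ae_restrict_mem measurableSet_uIoc).mono fun θ hθ => ?_
      rw [Set.uIoc_of_le hπ.le] at hθ
      -- Jordan's inequality bounds a negative power of the sine by a multiple of `θ^s` near `0`;
      -- the symmetry `θ ↦ 2π - θ` treats the other endpoint.
      have h1 : 2 / Real.pi * θ ≤ 2 * Real.sin (θ / 2) := by
        have := Real.mul_le_sin (x := θ / 2) (by linarith [hθ.1]) (by linarith [hθ.2])
        linarith
      have h2 : 0 < 2 / Real.pi * θ := mul_pos (by positivity) hθ.1
      have h3 := Real.rpow_le_rpow_of_nonpos h2 h1 h.le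
      rw [Real.mul_rpow (by positivity) hθ.1.le] at h3
      beta_reduce
      rw [Real.norm_of_nonneg (Real.rpow_nonneg (h2.le.trans h1) _)]
      exact h3.trans (le_abs_self _)
    have right := left.comp_sub_left (2 * Real.pi)
    rw [sub_zero, show 2 * Real.pi - Real.pi = Real.pi by ring] at right
    refine left.trans (right.symm.congr fun θ _ => ?_)
    have : (2 * Real.pi - θ) / 2 = Real.pi - θ / 2 := by ring
    simp only [this, Real.sin_pi_sub]

/-- The function `(2 sin(θ/2))^s e^{cθ}`. -/
def sinPowExp (s : ℝ) (c : ℂ) (θ : ℝ) : ℂ :=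
  (((2 * Real.sin (θ / 2)) ^ s : ℝ) : ℂ) * exp (c * θ)

theorem intervalIntegrable_sinPowExp {s : ℝ} (hs : -1 < s) (c : ℂ) :
    IntervalIntegrable (sinPowExp s c) MeasureTheory.volume 0 (2 * Real.pi) := by
  have h : IntervalIntegrable (fun θ : ℝ => (((2 * Real.sin (θ / 2)) ^ s : ℝ) : ℂ))
      MeasureTheory.volume 0 (2 * Real.pi) :=
    ⟨(intervalIntegrable_sin_half_rpow hs).1.ofReal, (intervalIntegrable_sin_half_rpow hs).2.ofReal⟩
  exact h.mul_continuousOn (by fun_prop)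

theorem sinPowExp_add (s : ℝ) (c d : ℂ) (θ : ℝ) :
    sinPowExp s (c + d) θ = sinPowExp s c θ * exp (d * θ) := by
  rw [sinPowExp, sinPowExp, add_mul, exp_add, mul_assoc]

/-- Integration by parts for `(2 sin(θ/2))^s e^{cθ}`, whose boundary values vanish. -/
theorem integral_deriv_sinPowExp {s : ℝ} (hs : 0 < s) (c : ℂ) :
    ∫ θ in (0 : ℝ)..2 * Real.pi,
      (c * sinPowExp s c θ + s * (Real.cos (θ / 2) * sinPowExp (s - 1) c θ)) = 0 := by
  have hπ := Real.pi_pos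
  have hd : ∀ θ ∈ Set.Ioo (0 : ℝ) (2 * Real.pi), HasDerivAt (sinPowExp s c)
      (c * sinPowExp s c θ + s * (Real.cos (θ / 2) * sinPowExp (s - 1) c θ)) θ := by
    intro θ hθ
    have h0 := sin_half_pos hθ
    have h1 : HasDerivAt (fun θ : ℝ => 2 * Real.sin (θ / 2)) (Real.cos (θ / 2)) θ := by
      have := ((Real.hasDerivAt_sin (θ / 2)).comp θ ((hasDerivAt_id θ).div_const 2)).const_mul 2
      refine this.congr_deriv ?_
      ring
    have h2 := (h1.rpow_const (p := s) (Or.inl (by positivity))).ofReal_comp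
    have h3 : HasDerivAt (fun θ : ℝ => exp (c * θ)) (exp (c * θ) * c) θ := by
      have := ((hasDerivAt_id θ).ofReal_comp.const_mul c).cexp
      simpa using this
    refine (h2.mul h3).congr_deriv ?_
    simp only [sinPowExp]
    push_cast
    ring
  rw [intervalIntegral.integral_eq_sub_of_hasDerivAt_of_le (by positivity) ?_ hd ?_]
  · have : 2 * Real.pi / 2 = Real.pi := by ring
    simp [sinPowExp, this, hs.ne']
  · refine Continuous.continuousOn ?_
    have h1 : Continuous fun θ : ℝ => (2 * Real.sin (θ / 2)) ^ s :=
      (by fun_prop : Continuous fun θ : ℝ => 2 * Real.sin (θ / 2)).rpow_const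
        fun _ => Or.inr hs.le
    unfold sinPowExp
    fun_prop
  · refine ((intervalIntegrable_sinPowExp (by linarith) c).const_mul c).add
      (IntervalIntegrable.const_mul ?_ _)
    exact (intervalIntegrable_sinPowExp (by linarith) c).continuousOn_mul (by fun_prop)

theorem exp_half_mul_self (θ : ℝ) :
    exp (I / 2 * θ) = Real.cos (θ / 2) + Real.sin (θ / 2) * I := by
  rw [show I / 2 * (θ : ℂ) = ((θ / 2 : ℝ) : ℂ) * I by push_cast; ring, exp_mul_I]
  simp

theorem exp_neg_half_mul_self (θ : ℝ) :
    exp (-(I / 2) * θ) = Real.cos (θ / 2) - Real.sin (θ / 2) * I := by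
  rw [show -(I / 2) * (θ : ℂ) = ((-(θ / 2) : ℝ) : ℂ) * I by push_cast; ring, exp_mul_I]
  simp [← sub_eq_add_neg]

/-- This is `integral_deriv_sinPowExp` at exponent `s + 1`, with `2c sin(θ/2) + (s+1) cos(θ/2)`
expanded in `e^{±iθ/2}`. -/
theorem integral_sinPowExp_recurrence {s : ℝ} (hs : -1 < s) (c : ℂ) :
    (-(I * c) + (s + 1) / 2) * (∫ θ in (0 : ℝ)..2 * Real.pi, sinPowExp s (c + I / 2) θ) +
      (I * c + (s + 1) / 2) * (∫ θ in (0 : ℝ)..2 * Real.pi, sinPowExp s (c + -(I / 2)) θ) = 0 := by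
  rw [← integral_deriv_sinPowExp (s := s + 1) (by linarith) c,
    ← intervalIntegral.integral_const_mul, ← intervalIntegral.integral_const_mul,
    ← intervalIntegral.integral_add]
  · refine intervalIntegral.integral_congr_Ioo_of_le (by positivity) fun θ hθ => ?_
    have h0 := sin_half_pos hθ
    have h1 : sinPowExp (s + 1) c θ = 2 * Real.sin (θ / 2) * sinPowExp s c θ := by
      rw [sinPowExp, sinPowExp, Real.rpow_add_one (by positivity)]
      push_cast
      ring
    simp only [sinPowExp_add, exp_half_mul_self, exp_neg_half_mul_self, add_sub_cancel_right, h1]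
    push_cast
    linear_combination (-2 * c * Complex.sin (θ / 2) * sinPowExp s c θ) * I_sq
  · exact (intervalIntegrable_sinPowExp hs _).const_mul _
  · exact (intervalIntegrable_sinPowExp hs _).const_mul _

/-! ### The weight on the circle and its moments. -/

theorem circleMap_eq_exp (θ : ℝ) : circleMap 0 1 θ = exp (I * θ) := by
  simp [circleMap, mul_comm]

theorem one_sub_circleMap (θ : ℝ) :
    1 - circleMap 0 1 θ =
      ((2 * Real.sin (θ / 2) : ℝ) : ℂ) * exp (((θ - Real.pi) / 2 : ℝ) * I) := by
  have e : I * (θ : ℂ) = I / 2 * θ + I / 2 * θ := by ring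
  have h2 : (θ - Real.pi) / 2 = θ / 2 - Real.pi / 2 := by ring
  have h3 := Complex.sin_sq_add_cos_sq (θ / 2 : ℝ)
  rw [circleMap_eq_exp, e, exp_add, exp_half_mul_self, exp_mul_I, ← ofReal_cos, ← ofReal_sin, h2,
    Real.cos_sub_pi_div_two, Real.sin_sub_pi_div_two]
  push_cast at h3 ⊢
  linear_combination -h3 - (Complex.sin (θ / 2)) ^ 2 * I_sq

theorem one_sub_one_div_circleMap (θ : ℝ) :
    1 - 1 / circleMap 0 1 θ =
      ((2 * Real.sin (θ / 2) : ℝ) : ℂ) * exp ((-((θ - Real.pi) / 2) : ℝ) * I) := by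
  have h := congrArg conj (one_sub_circleMap θ)
  rw [map_sub, map_one, map_mul, conj_ofReal, ← exp_conj, map_mul, conj_ofReal, conj_I] at h
  rw [one_div, show (circleMap 0 1 θ)⁻¹ = conj (circleMap 0 1 θ) by
    rw [circleMap_eq_exp, ← exp_neg, ← exp_conj]; simp, h]
  push_cast
  ring_nf

theorem log_ofReal_mul_exp_mul_I {r φ : ℝ} (hr : 0 < r) (h1 : -Real.pi < φ) (h2 : φ ≤ Real.pi) :
    Complex.log (r * exp (φ * I)) = Real.log r + φ * I := by
  rw [Complex.log_ofReal_mul hr (exp_ne_zero _), Complex.log_exp (by simpa using h1)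
    (by simpa using h2)]

/-- The arguments `±(θ - π)/2` lie in `(-π/2, π/2)`, so the principal logarithms are explicit; the
moduli contribute the exponent `a + b = 2α`, and the phases `(a - b) i (θ - π)/2 = -β(θ - π)`. -/
theorem pureSymbol_circleMap (α β : ℝ) {θ : ℝ} (hθ : θ ∈ Set.Ioo 0 (2 * Real.pi)) :
    pureSymbol α β (circleMap 0 1 θ) =
      exp (Real.pi * β) * sinPowExp (2 * α) (-β) θ := by
  have h0 : 0 < 2 * Real.sin (θ / 2) := by have := sin_half_pos hθ; positivity
  have hr : ((2 * Real.sin (θ / 2) : ℝ) : ℂ) ≠ 0 := by exact_mod_cast h0.ne'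
  have hπ := Real.pi_pos
  have hθ1 := hθ.1
  have hθ2 := hθ.2
  rw [pureSymbol, one_sub_circleMap, one_sub_one_div_circleMap,
    cpow_def_of_ne_zero (mul_ne_zero hr (exp_ne_zero _)),
    cpow_def_of_ne_zero (mul_ne_zero hr (exp_ne_zero _)),
    log_ofReal_mul_exp_mul_I h0 (by linarith) (by linarith),
    log_ofReal_mul_exp_mul_I h0 (by linarith) (by linarith), sinPowExp,
    Real.rpow_def_of_pos h0, ofReal_exp, ← exp_add, ← exp_add, ← exp_add]
  congr 1
  simp only [expA, expB]
  push_cast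
  linear_combination ((θ : ℂ) - Real.pi) * β * I_sq

theorem circleIntegral_div_I_mul (f : ℂ → ℂ) :
    (∮ z in C(0, 1), f z / (I * z)) = ∫ θ in (0 : ℝ)..2 * Real.pi, f (circleMap 0 1 θ) := by
  rw [circleIntegral]
  refine intervalIntegral.integral_congr fun θ _ => ?_
  have : circleMap 0 1 θ ≠ 0 := circleMap_ne_center one_ne_zero
  simp only [deriv_circleMap, smul_eq_mul]
  field_simp

/-- The trigonometric moments `∫ e^{ikθ} w(e^{iθ}) dθ`. -/
def moment (α β : ℝ) (k : ℤ) : ℂ :=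
  ∫ θ in (0 : ℝ)..2 * Real.pi, circleMap 0 1 θ ^ k * weight α β (circleMap 0 1 θ)

theorem circleMap_zpow_mul_weight (α β : ℝ) (k : ℤ) {θ : ℝ} (hθ : θ ∈ Set.Ioo 0 (2 * Real.pi)) :
    circleMap 0 1 θ ^ k * weight α β (circleMap 0 1 θ) =
      normConst α β * exp (Real.pi * β) * sinPowExp (2 * α) (I * k - β) θ := by
  rw [weight, pureSymbol_circleMap α β hθ, sub_eq_neg_add, sinPowExp_add, circleMap_eq_exp,
    ← exp_int_mul]
  ring_nf

theorem intervalIntegrable_zpow_mul_weight {α : ℝ} (hα : -1 / 2 < α) (β : ℝ) (k : ℤ) :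
    IntervalIntegrable (fun θ : ℝ => circleMap 0 1 θ ^ k * weight α β (circleMap 0 1 θ))
      MeasureTheory.volume 0 (2 * Real.pi) := by
  refine ((intervalIntegrable_sinPowExp (s := 2 * α) (by linarith) (I * k - β)).const_mul
    (normConst α β * exp (Real.pi * β))).congr_uIoo fun θ hθ => ?_
  rw [Set.uIoo_of_le (by positivity)] at hθ
  exact (circleMap_zpow_mul_weight α β k hθ).symm

theorem circleIntegrable_weight {α : ℝ} (hα : -1 / 2 < α) (β : ℝ) :
    CircleIntegrable (weight α β) 0 1 := by
  simpa [CircleIntegrable] using intervalIntegrable_zpow_mul_weight hα β 0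

theorem moment_eq (α β : ℝ) (k : ℤ) :
    moment α β k = normConst α β * exp (Real.pi * β) *
      ∫ θ in (0 : ℝ)..2 * Real.pi, sinPowExp (2 * α) (I * k - β) θ := by
  rw [moment, ← intervalIntegral.integral_const_mul]
  exact intervalIntegral.integral_congr_Ioo_of_le (by positivity)
    fun θ hθ => circleMap_zpow_mul_weight α β k hθ

/-- The choice `c = ik - β + i/2` makes `c ± i/2` the exponents of two consecutive moments. -/
theorem moment_recurrence {α : ℝ} (hα : -1 / 2 < α) (β : ℝ) (k : ℤ) :
    (k + 1 + expA α β) * moment α β (k + 1) = (k - expB α β) * moment α β k := by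
  have h := integral_sinPowExp_recurrence (s := 2 * α) (by linarith) (I * k - β + I / 2)
  rw [show I * (k : ℂ) - β + I / 2 + I / 2 = I * (k + 1 : ℤ) - β by push_cast; ring,
    show I * (k : ℂ) - β + I / 2 + -(I / 2) = I * k - β by ring] at h
  rw [moment_eq, moment_eq, expA, expB]
  push_cast at h ⊢
  linear_combination (normConst α β * exp (Real.pi * β)) * h +
    (normConst α β * exp (Real.pi * β)) * (k + 1 / 2) * ((∫ θ in (0 : ℝ)..2 * Real.pi,
      sinPowExp (2 * α) (I * (k + 1) - β) θ) - ∫ θ in (0 : ℝ)..2 * Real.pi,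
      sinPowExp (2 * α) (I * k - β) θ) * I_sq

theorem integral_sinPowExp_ofReal (s b : ℝ) :
    ∫ θ in (0 : ℝ)..2 * Real.pi, sinPowExp s b θ =
      ((∫ θ in (0 : ℝ)..2 * Real.pi, (2 * Real.sin (θ / 2)) ^ s * Real.exp (b * θ) : ℝ) : ℂ) := by
  rw [← intervalIntegral.integral_ofReal]
  simp [sinPowExp]

theorem integral_sin_half_rpow_mul_exp_pos {s : ℝ} (hs : -1 < s) (b : ℝ) :
    0 < ∫ θ in (0 : ℝ)..2 * Real.pi, (2 * Real.sin (θ / 2)) ^ s * Real.exp (b * θ) := by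
  refine intervalIntegral.intervalIntegral_pos_of_pos_on ?_ (fun θ hθ => ?_) (by positivity)
  · exact (intervalIntegrable_sin_half_rpow hs).mul_continuousOn (by fun_prop)
  · have := sin_half_pos hθ
    positivity

theorem symbolCoeff_zero (w : ℂ → ℂ) :
    symbolCoeff w 0 =
      (2 * (Real.pi : ℂ))⁻¹ * ∫ θ in (0 : ℝ)..2 * Real.pi, w (circleMap 0 1 θ) := by
  have h : (fun z => w z / z ^ ((0 : ℤ) + 1)) = fun z => I • (w z / (I * z)) := by
    ext z
    rw [zero_add, zpow_one, smul_eq_mul, div_mul_eq_div_div, div_right_comm,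
      mul_div_cancel₀ _ I_ne_zero]
  rw [symbolCoeff, h, circleIntegral.integral_smul, circleIntegral_div_I_mul, smul_eq_mul, mul_inv,
    mul_assoc, inv_mul_cancel_left₀ I_ne_zero]

theorem integral_pureSymbol (α β : ℝ) :
    ∫ θ in (0 : ℝ)..2 * Real.pi, pureSymbol α β (circleMap 0 1 θ) =
      ((Real.exp (Real.pi * β) * ∫ θ in (0 : ℝ)..2 * Real.pi,
        (2 * Real.sin (θ / 2)) ^ (2 * α) * Real.exp (-β * θ) : ℝ) : ℂ) := by
  rw [intervalIntegral.integral_congr_Ioo_of_le (by positivity)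
    fun θ hθ => pureSymbol_circleMap α β hθ, intervalIntegral.integral_const_mul, ofReal_mul,
    ← integral_sinPowExp_ofReal]
  push_cast
  rfl

theorem normConst_eq (α β : ℝ) :
    normConst α β = (∫ θ in (0 : ℝ)..2 * Real.pi, pureSymbol α β (circleMap 0 1 θ))⁻¹ := by
  have h : (2 * (Real.pi : ℂ)) ≠ 0 := by exact_mod_cast Real.two_pi_pos.ne'
  rw [normConst, symbolCoeff_zero, mul_inv_cancel_left₀ h]

/-- The positive integral of the symbol is what ensures that the inverse in `normConst` is genuine
and not the default value `0`. -/
theorem moment_zero {α : ℝ} (hα : -1 / 2 < α) (β : ℝ) : moment α β 0 = 1 := by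
  simp only [moment, zpow_zero, one_mul, weight]
  rw [intervalIntegral.integral_const_mul, normConst_eq, inv_mul_cancel₀]
  rw [integral_pureSymbol, ofReal_ne_zero]
  exact (mul_pos (Real.exp_pos _) (integral_sin_half_rpow_mul_exp_pos (by linarith) _)).ne'

theorem symbolCoeff_weight_zero {α : ℝ} (hα : -1 / 2 < α) (β : ℝ) :
    symbolCoeff (weight α β) 0 = 1 / (2 * (Real.pi : ℂ)) := by
  have h := moment_zero hα β
  simp only [moment, zpow_zero, one_mul] at h
  rw [symbolCoeff_zero, h, mul_one, one_div]

theorem conj_weight_circleMap (α β : ℝ) {θ : ℝ} (hθ : θ ∈ Set.Ioo 0 (2 * Real.pi)) :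
    conj (weight α β (circleMap 0 1 θ)) = weight α β (circleMap 0 1 θ) := by
  rw [weight, normConst_eq, integral_pureSymbol, pureSymbol_circleMap α β hθ, sinPowExp, map_mul,
    map_mul, map_mul, map_inv₀, conj_ofReal, conj_ofReal, ← exp_conj, ← exp_conj]
  simp

theorem conj_circleMap (θ : ℝ) : conj (circleMap 0 1 θ) = (circleMap 0 1 θ)⁻¹ := by
  rw [circleMap_eq_exp, ← exp_neg, ← exp_conj]
  simp

theorem conj_moment (α β : ℝ) (k : ℤ) : conj (moment α β k) = moment α β (-k) := by
  rw [moment, moment, intervalIntegral.integral_of_le (by positivity), ← integral_conj,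
    ← intervalIntegral.integral_of_le (by positivity)]
  refine intervalIntegral.integral_congr_Ioo_of_le (by positivity) fun θ hθ => ?_
  simp only [map_mul, map_zpow₀, conj_weight_circleMap α β hθ, conj_circleMap, inv_zpow, zpow_neg]

/-! ### Integrals against `w / (1 - z)`. -/

/-- This is `1/(1 - e^{iθ}) = 1/2 + (i/2) cot(θ/2)`; the cotangent lowers the exponent by one, hence
the later restriction to `s > 0`, and its integral is supplied by `integral_deriv_sinPowExp`. -/
theorem inv_one_sub_circleMap_mul (s : ℝ) (c : ℂ) {θ : ℝ} (hθ : θ ∈ Set.Ioo 0 (2 * Real.pi)) :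
    (1 - circleMap 0 1 θ)⁻¹ * sinPowExp s c θ =
      1 / 2 * sinPowExp s c θ + I * (Real.cos (θ / 2) * sinPowExp (s - 1) c θ) := by
  have h0 := sin_half_pos hθ
  have hs : (Real.sin (θ / 2) : ℂ) ≠ 0 := by exact_mod_cast h0.ne'
  have h1 : sinPowExp s c θ = 2 * Real.sin (θ / 2) * sinPowExp (s - 1) c θ := by
    rw [sinPowExp, sinPowExp, Real.rpow_sub_one (by positivity)]
    push_cast at hs ⊢
    field_simp
  have h2 : (1 - circleMap 0 1 θ) * (Real.sin (θ / 2) + I * Real.cos (θ / 2)) =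
      2 * Real.sin (θ / 2) := by
    have h3 := Complex.sin_sq_add_cos_sq (θ / 2 : ℝ)
    have e : ((θ - Real.pi) / 2 : ℝ) = θ / 2 - Real.pi / 2 := by ring
    rw [one_sub_circleMap, exp_mul_I, ← ofReal_cos, ← ofReal_sin, e, Real.cos_sub_pi_div_two,
      Real.sin_sub_pi_div_two]
    push_cast at h3 ⊢
    linear_combination 2 * Complex.sin (θ / 2) * h3 -
      2 * Complex.sin (θ / 2) * Complex.cos (θ / 2) ^ 2 * I_sq
  have h4 : 1 - circleMap 0 1 θ ≠ 0 := by
    intro h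
    rw [h, zero_mul] at h2
    exact hs (by simpa using h2.symm)
  rw [h1]
  field_simp
  linear_combination -sinPowExp (s - 1) c θ * h2

theorem intervalIntegrable_inv_one_sub_mul_sinPowExp {s : ℝ} (hs : 0 < s) (c : ℂ) :
    IntervalIntegrable (fun θ => (1 - circleMap 0 1 θ)⁻¹ * sinPowExp s c θ)
      MeasureTheory.volume 0 (2 * Real.pi) := by
  refine (((intervalIntegrable_sinPowExp (s := s) (by linarith) c).const_mul (1 / 2)).add
    (((intervalIntegrable_sinPowExp (s := s - 1) (by linarith) c).continuousOn_mul
      (g := fun θ : ℝ => (Real.cos (θ / 2) : ℂ)) (by fun_prop)).const_mul I)).congr_uIoo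
    fun θ hθ => ?_
  rw [Set.uIoo_of_le (by positivity)] at hθ
  exact (inv_one_sub_circleMap_mul s c hθ).symm

theorem integral_inv_one_sub_mul_sinPowExp {s : ℝ} (hs : 0 < s) (c : ℂ) :
    s * (∫ θ in (0 : ℝ)..2 * Real.pi, (1 - circleMap 0 1 θ)⁻¹ * sinPowExp s c θ) =
      (s / 2 - I * c) * ∫ θ in (0 : ℝ)..2 * Real.pi, sinPowExp s c θ := by
  have i1 := intervalIntegrable_sinPowExp (s := s) (by linarith) c
  have i2 := (intervalIntegrable_sinPowExp (s := s - 1) (by linarith) c).continuousOn_mul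
    (g := fun θ : ℝ => (Real.cos (θ / 2) : ℂ)) (by fun_prop)
  have h := integral_deriv_sinPowExp hs c
  rw [intervalIntegral.integral_add (i1.const_mul c) (i2.const_mul (s : ℂ)),
    intervalIntegral.integral_const_mul, intervalIntegral.integral_const_mul] at h
  rw [intervalIntegral.integral_congr_Ioo_of_le (by positivity)
    fun θ hθ => inv_one_sub_circleMap_mul s c hθ,
    intervalIntegral.integral_add (i1.const_mul _) (i2.const_mul _),
    intervalIntegral.integral_const_mul, intervalIntegral.integral_const_mul]
  linear_combination I * h

theorem circleMap_zpow_mul_weight_div (α β : ℝ) (k : ℤ) {θ : ℝ}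
    (hθ : θ ∈ Set.Ioo 0 (2 * Real.pi)) :
    circleMap 0 1 θ ^ k * weight α β (circleMap 0 1 θ) / (1 - circleMap 0 1 θ) =
      normConst α β * exp (Real.pi * β) *
        ((1 - circleMap 0 1 θ)⁻¹ * sinPowExp (2 * α) (I * k - β) θ) := by
  rw [circleMap_zpow_mul_weight α β k hθ]
  ring

theorem intervalIntegrable_zpow_mul_weight_div {α : ℝ} (hα : 0 < α) (β : ℝ) (k : ℤ) :
    IntervalIntegrable
      (fun θ : ℝ => circleMap 0 1 θ ^ k * weight α β (circleMap 0 1 θ) / (1 - circleMap 0 1 θ))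
      MeasureTheory.volume 0 (2 * Real.pi) := by
  refine ((intervalIntegrable_inv_one_sub_mul_sinPowExp (s := 2 * α) (by linarith)
    (I * k - β)).const_mul (normConst α β * exp (Real.pi * β))).congr_uIoo fun θ hθ => ?_
  rw [Set.uIoo_of_le (by positivity)] at hθ
  exact (circleMap_zpow_mul_weight_div α β k hθ).symm

theorem integral_zpow_mul_weight_div {α : ℝ} (hα : 0 < α) (β : ℝ) (k : ℤ) :
    2 * (α : ℂ) * (∫ θ in (0 : ℝ)..2 * Real.pi,
      circleMap 0 1 θ ^ k * weight α β (circleMap 0 1 θ) / (1 - circleMap 0 1 θ)) =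
      (k + expA α β) * moment α β k := by
  have h := integral_inv_one_sub_mul_sinPowExp (s := 2 * α) (by linarith) (I * k - β)
  rw [moment_eq, intervalIntegral.integral_congr_Ioo_of_le (by positivity)
    fun θ hθ => circleMap_zpow_mul_weight_div α β k hθ, intervalIntegral.integral_const_mul, expA]
  push_cast at h
  linear_combination (normConst α β * exp (Real.pi * β)) * h -
    (normConst α β * exp (Real.pi * β)) * k *
      (∫ θ in (0 : ℝ)..2 * Real.pi, sinPowExp (2 * α) (I * k - β) θ) * I_sq

/-! ### Polynomial inner products in terms of moments. -/

/-- The pairing `p ↦ ∫ p(z) z^(-k) w(z) dz / (iz)`, in terms of the moments `M` of `w`. -/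
def momentFunctional (M : ℤ → ℂ) (k : ℤ) : ℂ[X] →ₗ[ℂ] ℂ :=
  Polynomial.lsum fun i : ℕ => M (i - k) • LinearMap.id

theorem momentFunctional_eq_sum (M : ℤ → ℂ) (k : ℤ) {p : ℂ[X]} {N : ℕ} (hp : p.natDegree ≤ N) :
    momentFunctional M k p = ∑ i ∈ Finset.range (N + 1), p.coeff i * M (i - k) := by
  rw [momentFunctional, Polynomial.lsum_apply,
    Polynomial.sum_over_range' p _ (N + 1) (Nat.lt_succ_of_le hp)]
  · simp [mul_comm]
  · simp

theorem eval_mul_conj_eval_circleMap {p q : ℂ[X]} {m n : ℕ} (hp : p.natDegree ≤ m)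
    (hq : q.natDegree ≤ n) (θ : ℝ) :
    p.eval (circleMap 0 1 θ) * conj (q.eval (circleMap 0 1 θ)) =
      ∑ k ∈ Finset.range (n + 1), ∑ i ∈ Finset.range (m + 1),
        conj (q.coeff k) * p.coeff i * circleMap 0 1 θ ^ ((i : ℤ) - k) := by
  have h0 : circleMap 0 1 θ ≠ 0 := circleMap_ne_center one_ne_zero
  rw [eval_eq_sum_range' (Nat.lt_succ_of_le hp), eval_eq_sum_range' (Nat.lt_succ_of_le hq),
    map_sum, Finset.sum_mul_sum, Finset.sum_comm]
  refine Finset.sum_congr rfl fun k _ => Finset.sum_congr rfl fun i _ => ?_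
  rw [map_mul, map_pow, conj_circleMap, zpow_sub₀ h0, zpow_natCast, zpow_natCast, inv_pow]
  ring

theorem intervalIntegrable_fun_sum {ι : Type*} (s : Finset ι) {f : ι → ℝ → ℂ} {a b : ℝ}
    (h : ∀ i ∈ s, IntervalIntegrable (f i) MeasureTheory.volume a b) :
    IntervalIntegrable (fun θ => ∑ i ∈ s, f i θ) MeasureTheory.volume a b := by
  rw [← Finset.sum_fn]
  exact IntervalIntegrable.sum s h

section Weight

variable {α : ℝ}

theorem circleIntegral_eval_mul_conj_eval (hα : -1 / 2 < α) (β : ℝ) {p q : ℂ[X]} {n : ℕ}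
    (hq : q.natDegree ≤ n) :
    (∮ z in C(0, 1), p.eval z * conj (q.eval z) * weight α β z / (I * z)) =
      ∑ k ∈ Finset.range (n + 1), conj (q.coeff k) * momentFunctional (moment α β) k p := by
  have hi := intervalIntegrable_zpow_mul_weight hα β
  rw [circleIntegral_div_I_mul]
  simp only [eval_mul_conj_eval_circleMap le_rfl hq, Finset.sum_mul, mul_assoc]
  rw [intervalIntegral.integral_finsetSum]
  · refine Finset.sum_congr rfl fun k _ => ?_
    rw [intervalIntegral.integral_finsetSum, momentFunctional_eq_sum _ _ le_rfl, Finset.mul_sum]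
    · refine Finset.sum_congr rfl fun i _ => ?_
      rw [intervalIntegral.integral_const_mul, intervalIntegral.integral_const_mul, moment]
    · exact fun i _ => ((hi _).const_mul _).const_mul _
  · exact fun k _ => intervalIntegrable_fun_sum _ fun i _ => ((hi _).const_mul _).const_mul _

/-- The Hermitian symmetry of the moments allows expansion in the first factor instead of the
second, so that orthogonality can be applied to whichever factor has larger degree. -/
theorem circleIntegral_eval_mul_conj_eval' (hα : -1 / 2 < α) (β : ℝ) {p q : ℂ[X]} {n : ℕ}
    (hp : p.natDegree ≤ n) :
    (∮ z in C(0, 1), p.eval z * conj (q.eval z) * weight α β z / (I * z)) =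
      ∑ i ∈ Finset.range (n + 1), p.coeff i * conj (momentFunctional (moment α β) i q) := by
  rw [circleIntegral_eval_mul_conj_eval hα β le_rfl]
  simp only [momentFunctional_eq_sum _ _ hp, momentFunctional_eq_sum _ _ (le_refl q.natDegree),
    Finset.mul_sum, map_sum]
  rw [Finset.sum_comm]
  refine Finset.sum_congr rfl fun i _ => Finset.sum_congr rfl fun k _ => ?_
  rw [map_mul, conj_moment, neg_sub]
  ring

/-! ### Existence of the orthonormal system. -/

/-- The monic orthogonal polynomial of degree `n`. -/
def monicOrthogonal (α β : ℝ) (n : ℕ) : ℂ[X] :=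
  ∑ j ∈ Finset.range (n + 1), C (jacobiCoeff (expA α β) (expB α β) n j /
    (ascPochhammer ℂ n).eval (expA α β + 1)) * X ^ j

theorem coeff_monicOrthogonal (α β : ℝ) (n j : ℕ) :
    (monicOrthogonal α β n).coeff j = jacobiCoeff (expA α β) (expB α β) n j /
      (ascPochhammer ℂ n).eval (expA α β + 1) := by
  simp only [monicOrthogonal, finsetSum_coeff, coeff_C_mul, coeff_X_pow, mul_ite, mul_one,
    mul_zero, Finset.sum_ite_eq, Finset.mem_range]
  split_ifs with h
  · rfl
  · rw [jacobiCoeff_of_lt _ _ (by omega), zero_div]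

theorem re_expA (α β : ℝ) : (expA α β).re = α := by simp [expA]

theorem re_expB (α β : ℝ) : (expB α β).re = α := by simp [expB]

theorem natCast_add_one_add_expA_ne_zero (hα : -1 / 2 < α) (β : ℝ) (k : ℕ) :
    (k : ℂ) + 1 + expA α β ≠ 0 := by
  intro h
  have := congrArg Complex.re h
  simp only [add_re, natCast_re, one_re, re_expA, zero_re] at this
  have : (0 : ℝ) ≤ k := k.cast_nonneg
  linarith

theorem natCast_add_one_add_expB_ne_zero (hα : -1 / 2 < α) (β : ℝ) (k : ℕ) :
    (k : ℂ) + 1 + expB α β ≠ 0 := by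
  intro h
  have := congrArg Complex.re h
  simp only [add_re, natCast_re, one_re, re_expB, zero_re] at this
  have : (0 : ℝ) ≤ k := k.cast_nonneg
  linarith

theorem ascPochhammer_eval_expA_ne_zero (hα : -1 / 2 < α) (β : ℝ) (n : ℕ) :
    (ascPochhammer ℂ n).eval (expA α β + 1) ≠ 0 := by
  induction n with
  | zero => simp
  | succ n ih =>
    rw [ascPochhammer_succ_eval]
    refine mul_ne_zero ih ?_
    rw [add_assoc, add_comm, add_comm (1 : ℂ)]
    exact natCast_add_one_add_expA_ne_zero hα β n

theorem coeff_monicOrthogonal_self (hα : -1 / 2 < α) (β : ℝ) (n : ℕ) :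
    (monicOrthogonal α β n).coeff n = 1 := by
  rw [coeff_monicOrthogonal, jacobiCoeff_self, div_self (ascPochhammer_eval_expA_ne_zero hα β n)]

theorem natDegree_monicOrthogonal_le (α β : ℝ) (n : ℕ) :
    (monicOrthogonal α β n).natDegree ≤ n := by
  refine natDegree_le_iff_coeff_eq_zero.2 fun j hj => ?_
  rw [coeff_monicOrthogonal, jacobiCoeff_of_lt _ _ hj, zero_div]

theorem momentFunctional_monicOrthogonal (α β : ℝ) (M : ℤ → ℂ) (n : ℕ) (k : ℤ) :
    momentFunctional M k (monicOrthogonal α β n) =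
      jacobiPairing (expA α β) (expB α β) M n k / (ascPochhammer ℂ n).eval (expA α β + 1) := by
  rw [momentFunctional_eq_sum M k (natDegree_monicOrthogonal_le α β n), jacobiPairing,
    Finset.sum_div]
  refine Finset.sum_congr rfl fun j _ => ?_
  rw [coeff_monicOrthogonal]
  ring

theorem momentFunctional_monicOrthogonal_eq_zero (hα : -1 / 2 < α) (β : ℝ) {k n : ℕ}
    (h : k < n) : momentFunctional (moment α β) k (monicOrthogonal α β n) = 0 := by
  rw [momentFunctional_monicOrthogonal, jacobiPairing_eq_zero (moment_recurrence hα β) n k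
    (Int.natCast_nonneg k) (by exact_mod_cast h), zero_div]

/-- The squared norm of the monic orthogonal polynomial of degree `n`. -/
def monicNormSq (α β : ℝ) : ℕ → ℝ
  | 0 => 1
  | n + 1 => (n + 1) * (2 * α + n + 1) / ((n + 1 + α) ^ 2 + β ^ 2) * monicNormSq α β n

theorem monicNormSq_pos (hα : -1 / 2 < α) (β : ℝ) (n : ℕ) : 0 < monicNormSq α β n := by
  induction n with
  | zero => exact one_pos
  | succ n ih =>
    have hn : (0 : ℝ) ≤ n := n.cast_nonneg
    have h1 : 0 < 2 * α + n + 1 := by linarith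
    have h2 : 0 < n + 1 + α := by linarith
    rw [monicNormSq]
    positivity

theorem mul_expA_expB (α β x : ℝ) :
    ((x : ℂ) + expA α β) * (x + expB α β) = (((x + α) ^ 2 + β ^ 2 : ℝ) : ℂ) := by
  simp only [expA, expB]
  push_cast
  linear_combination -(β : ℂ) ^ 2 * I_sq

/-- `jacobiPairing_diag_succ` contributes `n + 1 + b` to the denominator and the normalising
Pochhammer symbol contributes `n + 1 + a`; their product is the real denominator of `monicNormSq`.
-/
theorem momentFunctional_monicOrthogonal_self (hα : -1 / 2 < α) (β : ℝ) (n : ℕ) :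
    momentFunctional (moment α β) n (monicOrthogonal α β n) = monicNormSq α β n := by
  induction n with
  | zero =>
    rw [momentFunctional_monicOrthogonal]
    simp [jacobiPairing, jacobiCoeff, moment_zero hα β, monicNormSq]
  | succ n ih =>
    have hA := natCast_add_one_add_expA_ne_zero hα β n
    have hB := natCast_add_one_add_expB_ne_zero hα β n
    have hP := ascPochhammer_eval_expA_ne_zero hα β n
    have h := jacobiPairing_diag_succ (moment_recurrence hα β)
      (natCast_add_one_add_expB_ne_zero hα β) n
    rw [momentFunctional_monicOrthogonal, div_eq_iff hP] at ih
    have e : expA α β + 1 + n = n + 1 + expA α β := by ring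
    have h2 : expA α β + expB α β = 2 * α := by simp only [expA, expB]; ring
    have h3 := mul_expA_expB α β (n + 1)
    rw [momentFunctional_monicOrthogonal, ascPochhammer_succ_eval, e,
      div_eq_iff (mul_ne_zero hP hA), monicNormSq, ofReal_mul, ofReal_div, ← h3]
    push_cast at h ⊢
    rw [ih, h2] at h
    refine mul_left_cancel₀ hB ?_
    rw [h]
    field_simp

/-- The orthonormal polynomials. -/
def orthonormalPoly (α β : ℝ) (n : ℕ) : ℂ[X] :=
  C (((√(monicNormSq α β n))⁻¹ : ℝ) : ℂ) * monicOrthogonal α β n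

theorem coeff_orthonormalPoly_self (hα : -1 / 2 < α) (β : ℝ) (n : ℕ) :
    (orthonormalPoly α β n).coeff n = (((√(monicNormSq α β n))⁻¹ : ℝ) : ℂ) := by
  rw [orthonormalPoly, coeff_C_mul, coeff_monicOrthogonal_self hα, mul_one]

theorem natDegree_orthonormalPoly_le (α β : ℝ) (n : ℕ) :
    (orthonormalPoly α β n).natDegree ≤ n :=
  (natDegree_C_mul_le _ _).trans (natDegree_monicOrthogonal_le α β n)

theorem momentFunctional_C_mul (M : ℤ → ℂ) (k : ℤ) (c : ℂ) (p : ℂ[X]) :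
    momentFunctional M k (C c * p) = c * momentFunctional M k p := by
  rw [← smul_eq_C_mul, map_smul, smul_eq_mul]

theorem momentFunctional_orthonormalPoly_eq_zero (hα : -1 / 2 < α) (β : ℝ) {k n : ℕ}
    (h : k < n) : momentFunctional (moment α β) k (orthonormalPoly α β n) = 0 := by
  rw [orthonormalPoly, momentFunctional_C_mul, momentFunctional_monicOrthogonal_eq_zero hα β h,
    mul_zero]

theorem momentFunctional_orthonormalPoly_self (hα : -1 / 2 < α) (β : ℝ) (n : ℕ) :
    momentFunctional (moment α β) n (orthonormalPoly α β n) = (√(monicNormSq α β n) : ℝ) := by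
  have h := monicNormSq_pos hα β n
  rw [orthonormalPoly, momentFunctional_C_mul, momentFunctional_monicOrthogonal_self hα β,
    ← ofReal_mul, inv_mul_eq_div, Real.div_sqrt]

theorem isOrthonormalSystem_orthonormalPoly (hα : -1 / 2 < α) (β : ℝ) :
    IsOrthonormalSystem (weight α β) (orthonormalPoly α β) where
  natDegree_eq n := by
    refine natDegree_eq_of_le_of_coeff_ne_zero (natDegree_orthonormalPoly_le α β n) ?_
    rw [coeff_orthonormalPoly_self hα, ofReal_ne_zero]
    exact (inv_pos.2 (Real.sqrt_pos.2 (monicNormSq_pos hα β n))).ne'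
  leading_pos n := by
    rw [coeff_orthonormalPoly_self hα, ofReal_im, ofReal_re]
    exact ⟨rfl, inv_pos.2 (Real.sqrt_pos.2 (monicNormSq_pos hα β n))⟩
  orthonormal m n := by
    rcases lt_trichotomy m n with h | h | h
    · rw [if_neg h.ne, circleIntegral_eval_mul_conj_eval' hα β (natDegree_orthonormalPoly_le α β m)]
      refine Finset.sum_eq_zero fun k hk => ?_
      rw [Finset.mem_range] at hk
      rw [momentFunctional_orthonormalPoly_eq_zero hα β (by omega), map_zero, mul_zero]
    · subst h
      rw [if_pos rfl, circleIntegral_eval_mul_conj_eval hα β (natDegree_orthonormalPoly_le α β m),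
        Finset.sum_range_succ, Finset.sum_eq_zero fun k hk => ?_]
      · rw [coeff_orthonormalPoly_self hα, momentFunctional_orthonormalPoly_self hα β, conj_ofReal,
          ← ofReal_mul, inv_mul_cancel₀ (Real.sqrt_pos.2 (monicNormSq_pos hα β m)).ne', ofReal_one,
          zero_add]
      · rw [momentFunctional_orthonormalPoly_eq_zero hα β (Finset.mem_range.1 hk), mul_zero]
    · rw [if_neg h.ne', circleIntegral_eval_mul_conj_eval hα β (natDegree_orthonormalPoly_le α β n)]
      refine Finset.sum_eq_zero fun k hk => ?_
      rw [Finset.mem_range] at hk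
      rw [momentFunctional_orthonormalPoly_eq_zero hα β (by omega), mul_zero]

/-! ### Uniqueness of the orthonormal system. -/

/-- Orthogonality to `φ_k` reduces by induction to orthogonality to its leading monomial, whose
coefficient is nonzero. -/
theorem IsOrthonormalSystem.momentFunctional_eq_zero (hα : -1 / 2 < α) {β : ℝ} {φ : ℕ → ℂ[X]}
    (hφ : IsOrthonormalSystem (weight α β) φ) {k n : ℕ} (hk : k < n) :
    momentFunctional (moment α β) k (φ n) = 0 := by
  induction k using Nat.strong_induction_on with
  | _ k ih =>
    have h := hφ.orthonormal n k
    rw [if_neg hk.ne', circleIntegral_eval_mul_conj_eval hα β (hφ.natDegree_eq k).le,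
      Finset.sum_range_succ, Finset.sum_eq_zero fun j hj => ?_, zero_add, mul_eq_zero] at h
    · refine h.resolve_left fun h0 => (hφ.leading_pos k).2.ne' ?_
      rw [(map_eq_zero _).1 h0, zero_re]
    · rw [Finset.mem_range] at hj
      rw [ih j hj (hj.trans hk), mul_zero]

/-- Pairing `p` with the monic orthogonal polynomial of the same degree gives `0` when expanded in
the latter, and the leading coefficient of `p` times a positive norm when expanded in `p`. -/
theorem eq_zero_of_momentFunctional_eq_zero (hα : -1 / 2 < α) (β : ℝ) {p : ℂ[X]}
    (hp : ∀ k : ℕ, k ≤ p.natDegree → momentFunctional (moment α β) k p = 0) : p = 0 := by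
  have h := circleIntegral_eval_mul_conj_eval hα β (p := p)
    (natDegree_monicOrthogonal_le α β p.natDegree)
  rw [circleIntegral_eval_mul_conj_eval' hα β le_rfl, Finset.sum_range_succ,
    Finset.sum_eq_zero fun k hk => ?_, Finset.sum_eq_zero fun k hk => ?_,
    momentFunctional_monicOrthogonal_self hα, conj_ofReal, zero_add, mul_eq_zero] at h
  · rw [← leadingCoeff_eq_zero]
    refine h.resolve_right ?_
    exact ofReal_ne_zero.2 (monicNormSq_pos hα β _).ne'
  · rw [hp k (by simpa [Nat.lt_succ_iff] using hk), mul_zero]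
  · rw [momentFunctional_monicOrthogonal_eq_zero hα β (Finset.mem_range.1 hk), map_zero, mul_zero]

/-- Subtracting the matching multiple of the monic polynomial leaves degree below `n`, with
vanishing pairings, hence zero. Unit norm and positivity then fix the multiple. -/
theorem IsOrthonormalSystem.eq_orthonormalPoly (hα : -1 / 2 < α) {β : ℝ} {φ : ℕ → ℂ[X]}
    (hφ : IsOrthonormalSystem (weight α β) φ) : φ = orthonormalPoly α β := by
  funext n
  have h1 : φ n = C ((φ n).coeff n) * monicOrthogonal α β n := by
    rw [← sub_eq_zero]
    set p := φ n - C ((φ n).coeff n) * monicOrthogonal α β n with hp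
    by_contra hne
    have hle : p.natDegree ≤ n := max_self n ▸ (natDegree_sub_le_of_le (hφ.natDegree_eq n).le
      ((natDegree_C_mul_le _ _).trans (natDegree_monicOrthogonal_le α β n)))
    have hc : p.coeff n = 0 := by
      rw [hp, coeff_sub, coeff_C_mul, coeff_monicOrthogonal_self hα, mul_one, sub_self]
    have hlt : p.natDegree < n := by
      refine lt_of_le_of_ne hle fun h => hne ?_
      rwa [← leadingCoeff_eq_zero, leadingCoeff, h]
    refine hne (eq_zero_of_momentFunctional_eq_zero hα β fun k hk => ?_)
    rw [hp, map_sub, momentFunctional_C_mul,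
      momentFunctional_monicOrthogonal_eq_zero hα β (hk.trans_lt hlt),
      hφ.momentFunctional_eq_zero hα (hk.trans_lt hlt), mul_zero, sub_zero]
  obtain ⟨him, hre⟩ := hφ.leading_pos n
  have hk : (φ n).coeff n = ((φ n).coeff n).re := Complex.ext (by simp) (by simpa using him)
  set κ := ((φ n).coeff n).re
  have h2 := hφ.orthonormal n n
  rw [if_pos rfl, circleIntegral_eval_mul_conj_eval hα β (hφ.natDegree_eq n).le,
    Finset.sum_range_succ, Finset.sum_eq_zero fun j hj => ?_, zero_add, h1,
    momentFunctional_C_mul, momentFunctional_monicOrthogonal_self hα, ← h1, hk, conj_ofReal] at h2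
  · have h3 : κ * (κ * monicNormSq α β n) = 1 := by exact_mod_cast h2
    have h4 : monicNormSq α β n = (κ⁻¹) ^ 2 := by field_simp; linear_combination h3
    rw [h1, hk, orthonormalPoly, h4, Real.sqrt_sq (inv_pos.2 hre).le, inv_inv]
  · rw [hφ.momentFunctional_eq_zero hα (Finset.mem_range.1 hj), mul_zero]

end Weight

/-! ### Closed forms for `m_n`, `k_n`, `r_n`, `l_n` and `φ_n(0)`. -/

section Values

variable {α : ℝ}

theorem kCoeff_orthonormalPoly (hα : -1 / 2 < α) (β : ℝ) (n : ℕ) :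
    kCoeff (orthonormalPoly α β) n = (√(monicNormSq α β n))⁻¹ := by
  change ((orthonormalPoly α β n).coeff n).re = _
  rw [coeff_orthonormalPoly_self hα, ofReal_re]

theorem kCoeff_orthonormalPoly_sq (hα : -1 / 2 < α) (β : ℝ) (n : ℕ) :
    kCoeff (orthonormalPoly α β) n ^ 2 = (monicNormSq α β n)⁻¹ := by
  rw [kCoeff_orthonormalPoly hα, inv_pow, Real.sq_sqrt (monicNormSq_pos hα β n).le]

theorem kCoeff_orthonormalPoly_pos (hα : -1 / 2 < α) (β : ℝ) (n : ℕ) :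
    0 < kCoeff (orthonormalPoly α β) n := by
  rw [kCoeff_orthonormalPoly hα]
  exact inv_pos.2 (Real.sqrt_pos.2 (monicNormSq_pos hα β n))

theorem mRatio_orthonormalPoly_sq_mul (hα : -1 / 2 < α) (β : ℝ) (n : ℕ) :
    (mRatio (orthonormalPoly α β) n : ℂ) ^ 2 * ((expA α β + n + 1) * (expB α β + n + 1)) =
      (n + 1) * (2 * α + n + 1) := by
  have h1 := (monicNormSq_pos hα β n).ne'
  have hn : (0 : ℝ) ≤ n := n.cast_nonneg
  have h2 : 0 < (n + 1 + α) ^ 2 + β ^ 2 := by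
    have : 0 < n + 1 + α := by linarith
    positivity
  have h3 := mul_expA_expB α β (n + 1)
  have h4 : mRatio (orthonormalPoly α β) n ^ 2 * ((n + 1 + α) ^ 2 + β ^ 2) =
      (n + 1) * (2 * α + n + 1) := by
    rw [mRatio, div_pow, kCoeff_orthonormalPoly_sq hα,
      show (n : ℤ) + 1 = (n + 1 : ℕ) by push_cast; rfl, kCoeff_orthonormalPoly_sq hα, monicNormSq]
    field_simp
  rw [show (expA α β + n + 1) * (expB α β + n + 1) =
    (((n + 1 : ℝ) : ℂ) + expA α β) * (((n + 1 : ℝ) : ℂ) + expB α β) by push_cast; ring, h3]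
  exact_mod_cast h4

theorem expA_mul_expB_ne_zero (hα : -1 / 2 < α) (β : ℝ) (n : ℕ) :
    (expA α β + n + 1) * (expB α β + n + 1) ≠ 0 := by
  refine mul_ne_zero ?_ ?_
  · convert natCast_add_one_add_expA_ne_zero hα β n using 1
    ring
  · convert natCast_add_one_add_expB_ne_zero hα β n using 1
    ring

/-- Consecutive values of `(n + 1)(2α + n + 1)` differ by `2α + 2n + 1`. -/
theorem mRatio_difference_equation (hα : -1 / 2 < α) (β : ℝ) (n : ℕ) :
    2 * (α : ℂ) + 2 * (n : ℂ) + 1 =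
      (mRatio (orthonormalPoly α β) n : ℂ) ^ 2 * (expA α β + n + 1) * (expB α β + n + 1) -
        (mRatio (orthonormalPoly α β) ((n : ℤ) - 1) : ℂ) ^ 2 *
          (expA α β + n) * (expB α β + n) := by
  have h1 := mRatio_orthonormalPoly_sq_mul hα β n
  rcases n with _ | n
  -- For `n = 0` the second term drops out because `k_{-1} = 0`.
  · have h2 : mRatio (orthonormalPoly α β) (((0 : ℕ) : ℤ) - 1) = 0 := by
      change kCoeff _ (Int.negSucc 0) / _ = 0
      rw [kCoeff, zero_div]
    rw [h2]
    push_cast at h1 ⊢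
    linear_combination -h1
  · have h2 := mRatio_orthonormalPoly_sq_mul hα β n
    rw [show ((n + 1 : ℕ) : ℤ) - 1 = n by push_cast; ring]
    push_cast at h1 h2 ⊢
    linear_combination -h1 + h2

theorem mRatio_orthonormalPoly_sq (hα : -1 / 2 < α) (β : ℝ) (n : ℕ) :
    (mRatio (orthonormalPoly α β) n : ℂ) ^ 2 =
      ((n : ℂ) + 1) * (2 * (α : ℂ) + n + 1) / ((expA α β + n + 1) * (expB α β + n + 1)) :=
  eq_div_of_mul_eq (expA_mul_expB_ne_zero hα β n) (mRatio_orthonormalPoly_sq_mul hα β n)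

theorem kCoeff_orthonormalPoly_sq_succ (hα : -1 / 2 < α) (β : ℝ) (n : ℕ) :
    ((n : ℂ) + 1) * (2 * α + n + 1) * (kCoeff (orthonormalPoly α β) (n + 1 : ℕ) : ℂ) ^ 2 =
      (expA α β + n + 1) * (expB α β + n + 1) * (kCoeff (orthonormalPoly α β) n : ℂ) ^ 2 := by
  have h := mRatio_orthonormalPoly_sq_mul hα β n
  have h1 : (kCoeff (orthonormalPoly α β) (n + 1 : ℕ) : ℂ) ≠ 0 :=
    ofReal_ne_zero.2 (kCoeff_orthonormalPoly_pos hα β (n + 1)).ne'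
  rw [mRatio, ofReal_div, div_pow, show (n : ℤ) + 1 = (n + 1 : ℕ) by push_cast; rfl] at h
  rw [← h]
  field_simp

theorem kCoeff_orthonormalPoly_zero (hα : -1 / 2 < α) (β : ℝ) :
    kCoeff (orthonormalPoly α β) 0 = 1 := by
  have h := kCoeff_orthonormalPoly hα β 0
  simpa [monicNormSq] using h

theorem kCoeff_orthonormalPoly_sq_eq_Gamma (hα : -1 / 2 < α) (β : ℝ) (n : ℕ) :
    (kCoeff (orthonormalPoly α β) n : ℂ) ^ 2 =
      Complex.Gamma (2 * (α : ℂ) + 1) /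
          (Complex.Gamma (expB α β + 1) * Complex.Gamma (expA α β + 1)) *
        (Complex.Gamma (expA α β + n + 1) / Complex.Gamma ((n : ℂ) + 1)) *
        (Complex.Gamma (expB α β + n + 1) / Complex.Gamma ((n : ℂ) + 2 * (α : ℂ) + 1)) := by
  have hre : ∀ m : ℕ, (0 : ℝ) ≤ m := fun m => m.cast_nonneg
  have hA : ∀ m : ℕ, Complex.Gamma (expA α β + m + 1) ≠ 0 := fun m =>
    Complex.Gamma_ne_zero_of_re_pos (by simp [re_expA]; linarith [hre m])
  have hB : ∀ m : ℕ, Complex.Gamma (expB α β + m + 1) ≠ 0 := fun m =>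
    Complex.Gamma_ne_zero_of_re_pos (by simp [re_expB]; linarith [hre m])
  have h1 : ∀ m : ℕ, Complex.Gamma ((m : ℂ) + 1) ≠ 0 := fun m =>
    Complex.Gamma_ne_zero_of_re_pos (by simp; linarith [hre m])
  have h2 : ∀ m : ℕ, Complex.Gamma ((m : ℂ) + 2 * (α : ℂ) + 1) ≠ 0 := fun m =>
    Complex.Gamma_ne_zero_of_re_pos (by simp; linarith [hre m])
  induction n with
  | zero =>
    have hA0 := hA 0
    have hB0 := hB 0
    have h20 := h2 0
    simp only [Nat.cast_zero, add_zero, zero_add] at hA0 hB0 h20 ⊢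
    rw [kCoeff_orthonormalPoly_zero hα, Complex.Gamma_one]
    field_simp
    simp
  | succ n ih =>
    have hk := kCoeff_orthonormalPoly_sq_succ hα β n
    have hn1 : (n : ℂ) + 1 ≠ 0 := n.cast_add_one_ne_zero
    have hn2 : (n : ℂ) + 2 * α + 1 ≠ 0 := by
      have : (n : ℝ) + 2 * α + 1 ≠ 0 := by linarith [hre n]
      exact_mod_cast this
    have hn2' : 2 * (α : ℂ) + n + 1 ≠ 0 := by rwa [add_comm (2 * (α : ℂ))]
    have e1 : expA α β + (n + 1 : ℕ) + 1 = expA α β + n + 1 + 1 := by push_cast; ring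
    have e2 : expB α β + (n + 1 : ℕ) + 1 = expB α β + n + 1 + 1 := by push_cast; ring
    have e3 : ((n + 1 : ℕ) : ℂ) + 1 = n + 1 + 1 := by push_cast; ring
    have e4 : ((n + 1 : ℕ) : ℂ) + 2 * α + 1 = n + 2 * α + 1 + 1 := by push_cast; ring
    have hAB := expA_mul_expB_ne_zero hα β n
    refine mul_left_cancel₀ (mul_ne_zero hn1 hn2') ?_
    rw [hk, ih, e1, e2, e3, e4, Complex.Gamma_add_one _ (left_ne_zero_of_mul hAB),
      Complex.Gamma_add_one _ (right_ne_zero_of_mul hAB), Complex.Gamma_add_one _ hn1,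
      Complex.Gamma_add_one _ hn2]
    have := h1 n
    have := h2 n
    field_simp
    ring

theorem eval_zero_orthonormalPoly (hα : -1 / 2 < α) (β : ℝ) (n : ℕ) :
    (orthonormalPoly α β n).eval 0 = kCoeff (orthonormalPoly α β) n *
      ((ascPochhammer ℂ n).eval (expB α β) / (ascPochhammer ℂ n).eval (expA α β + 1)) := by
  rw [← coeff_zero_eq_eval_zero, orthonormalPoly, coeff_C_mul, coeff_monicOrthogonal,
    kCoeff_orthonormalPoly hα]
  simp [jacobiCoeff]

theorem rRatio_orthonormalPoly (hα : -1 / 2 < α) (β : ℝ) (n : ℕ) :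
    rRatio (orthonormalPoly α β) n =
      (ascPochhammer ℂ n).eval (expB α β) / (ascPochhammer ℂ n).eval (expA α β + 1) := by
  rw [rRatio, eval_zero_orthonormalPoly hα, mul_div_cancel_left₀]
  exact ofReal_ne_zero.2 (kCoeff_orthonormalPoly_pos hα β n).ne'

theorem rRatio_orthonormalPoly_succ (hα : -1 / 2 < α) (β : ℝ) (n : ℕ) :
    (expA α β + n + 1) * rRatio (orthonormalPoly α β) (n + 1) =
      ((n : ℂ) + expB α β) * rRatio (orthonormalPoly α β) n := by
  have h1 := left_ne_zero_of_mul (expA_mul_expB_ne_zero hα β n)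
  have h2 := ascPochhammer_eval_expA_ne_zero hα β n
  have e : expA α β + 1 + n = expA α β + n + 1 := by ring
  rw [rRatio_orthonormalPoly hα, rRatio_orthonormalPoly hα, ascPochhammer_succ_eval,
    ascPochhammer_succ_eval, e]
  field_simp
  ring

/-- For `n ≥ 1` the real part is positive; at `n = 0` the number is `b` itself, the only place where
`(α, β) ≠ (0, 0)` matters. -/
theorem natCast_add_expB_ne_zero (hα : -1 / 2 < α) {β : ℝ} (h : α ≠ 0 ∨ β ≠ 0) (n : ℕ) :
    (n : ℂ) + expB α β ≠ 0 := by
  rcases n with _ | n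
  · rw [Nat.cast_zero, zero_add]
    intro h0
    have h1 := congrArg Complex.re h0
    have h2 := congrArg Complex.im h0
    simp [expB] at h1 h2
    exact h.elim (· h1) (· h2)
  · have := natCast_add_one_add_expB_ne_zero hα β n
    push_cast
    exact this

theorem rRatio_orthonormalPoly_ne_zero (hα : -1 / 2 < α) {β : ℝ} (h : α ≠ 0 ∨ β ≠ 0) (n : ℕ) :
    rRatio (orthonormalPoly α β) n ≠ 0 := by
  rw [rRatio_orthonormalPoly hα]
  refine div_ne_zero ?_ (ascPochhammer_eval_expA_ne_zero hα β n)
  induction n with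
  | zero => simp
  | succ n ih =>
    rw [ascPochhammer_succ_eval, add_comm (expB α β)]
    exact mul_ne_zero ih (natCast_add_expB_ne_zero hα h n)

theorem lCoeff_orthonormalPoly (hα : -1 / 2 < α) (β : ℝ) {n : ℕ} (hn : 1 ≤ n) :
    lCoeff (orthonormalPoly α β) n =
      expB α β * n / ((n : ℂ) + expA α β) * (kCoeff (orthonormalPoly α β) n : ℂ) := by
  obtain ⟨n, rfl⟩ := Nat.exists_eq_add_of_le' hn
  have h1 := natCast_add_one_add_expA_ne_zero hα β n
  have h2 := ascPochhammer_eval_expA_ne_zero hα β n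
  have e : expA α β + 1 + n = n + 1 + expA α β := by ring
  rw [lCoeff, Nat.add_sub_cancel, orthonormalPoly, coeff_C_mul, coeff_monicOrthogonal,
    kCoeff_orthonormalPoly hα, jacobiCoeff, ascPochhammer_succ_eval, e, Nat.add_sub_cancel_left,
    Nat.choose_succ_self_right, ascPochhammer_one, eval_X]
  push_cast
  field_simp

theorem norm_natCast_add_expB (α β : ℝ) (n : ℕ) :
    ‖(n : ℂ) + expB α β‖ = ‖expA α β + n‖ := by
  rw [← Complex.norm_conj]
  congr 1
  simp [expA, expB, add_comm]

/-- The recursions for `k_n^2` and `r_n` are multiplied in absolute value; as `a` and `b` are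
conjugate, the factors `|a + n + 1|` cancel. -/
theorem norm_sq_eval_zero_orthonormalPoly_succ (hα : -1 / 2 < α) (β : ℝ) (n : ℕ) :
    (n + 1) * (2 * α + n + 1) * ‖(orthonormalPoly α β (n + 1)).eval 0‖ ^ 2 =
      ‖expA α β + n‖ ^ 2 * ‖(orthonormalPoly α β n).eval 0‖ ^ 2 := by
  have hn : (0 : ℝ) ≤ n := n.cast_nonneg
  have hk : ∀ m, (orthonormalPoly α β m).eval 0 =
      kCoeff (orthonormalPoly α β) m * rRatio (orthonormalPoly α β) m := fun m => by
    rw [eval_zero_orthonormalPoly hα, rRatio_orthonormalPoly hα]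
  have h1 := congrArg norm (kCoeff_orthonormalPoly_sq_succ hα β n)
  have h2 := congrArg norm (rRatio_orthonormalPoly_succ hα β n)
  have e1 : ‖(n : ℂ) + 1‖ = n + 1 := by
    rw [show (n : ℂ) + 1 = ((n + 1 : ℝ) : ℂ) by push_cast; rfl,
      Complex.norm_of_nonneg (by linarith)]
  have e2 : ‖2 * (α : ℂ) + n + 1‖ = 2 * α + n + 1 := by
    rw [show 2 * (α : ℂ) + n + 1 = ((2 * α + n + 1 : ℝ) : ℂ) by push_cast; rfl,
      Complex.norm_of_nonneg (by linarith)]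
  have e3 : ‖expB α β + n + 1‖ = ‖expA α β + n + 1‖ := by
    have := norm_natCast_add_expB α β (n + 1)
    push_cast at this
    rw [← add_assoc] at this
    rw [← this]
    congr 1
    ring
  have h0 : ‖expA α β + n + 1‖ ≠ 0 :=
    norm_ne_zero_iff.2 (left_ne_zero_of_mul (expA_mul_expB_ne_zero hα β n))
  simp only [norm_mul, norm_pow, e1, e2, e3, norm_natCast_add_expB] at h1 h2
  rw [hk, hk, norm_mul, norm_mul, mul_pow, mul_pow, ← mul_assoc, h1]
  linear_combination ‖(kCoeff (orthonormalPoly α β) n : ℂ)‖ ^ 2 *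
    (‖expA α β + n + 1‖ * ‖rRatio (orthonormalPoly α β) (n + 1)‖ +
      ‖expA α β + n‖ * ‖rRatio (orthonormalPoly α β) n‖) * h2

theorem norm_sq_eval_zero_orthonormalPoly (hα : -1 / 2 < α) {β : ℝ} (h : α ≠ 0 ∨ β ≠ 0) (n : ℕ) :
    ‖(orthonormalPoly α β n).eval 0‖ ^ 2 =
      Real.Gamma (2 * α + 1) / (Real.Gamma ((n : ℝ) + 1) * Real.Gamma ((n : ℝ) + 2 * α + 1)) *
        (‖Complex.Gamma (expA α β + n)‖ ^ 2 / ‖Complex.Gamma (expA α β)‖ ^ 2) := by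
  have hA : ∀ m : ℕ, expA α β + m ≠ 0 := fun m => by
    rw [← norm_ne_zero_iff, ← norm_natCast_add_expB, norm_ne_zero_iff]
    exact natCast_add_expB_ne_zero hα h m
  -- Here `a` may have nonpositive real part, so the poles `-m` are excluded directly through `a + m
  -- ≠ 0`.
  have hG : ‖Complex.Gamma (expA α β)‖ ≠ 0 := by
    rw [norm_ne_zero_iff]
    refine Complex.Gamma_ne_zero fun m hm => hA m ?_
    rw [hm, neg_add_cancel]
  have h1 : ∀ m : ℕ, Real.Gamma ((m : ℝ) + 1) ≠ 0 := fun m =>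
    (Real.Gamma_pos_of_pos (by positivity)).ne'
  have h2 : ∀ m : ℕ, 0 < (m : ℝ) + 2 * α + 1 := fun m => by
    linarith [(m.cast_nonneg : (0 : ℝ) ≤ m)]
  have h2G : ∀ m : ℕ, Real.Gamma ((m : ℝ) + 2 * α + 1) ≠ 0 := fun m =>
    (Real.Gamma_pos_of_pos (h2 m)).ne'
  induction n with
  | zero =>
    have h20 := h2G 0
    rw [eval_zero_orthonormalPoly hα]
    simp only [Nat.cast_zero, zero_add, add_zero, kCoeff_orthonormalPoly_zero hα,
      Real.Gamma_one] at h20 ⊢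
    rw [div_self (pow_ne_zero 2 hG), one_mul, div_self h20]
    simp
  | succ n ih =>
    have hs := norm_sq_eval_zero_orthonormalPoly_succ hα β n
    have hn1 : (n : ℝ) + 1 ≠ 0 := n.cast_add_one_ne_zero
    have hn2' : 2 * α + n + 1 ≠ 0 := by linarith [h2 n]
    have e3 : ((n + 1 : ℕ) : ℝ) + 1 = n + 1 + 1 := by push_cast; ring
    have e4 : ((n + 1 : ℕ) : ℝ) + 2 * α + 1 = n + 2 * α + 1 + 1 := by push_cast; ring
    have e5 : expA α β + (n + 1 : ℕ) = expA α β + n + 1 := by push_cast; ring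
    refine mul_left_cancel₀ (mul_ne_zero hn1 hn2') ?_
    rw [hs, ih, e3, e4, e5, Complex.Gamma_add_one _ (hA n), Real.Gamma_add_one hn1,
      Real.Gamma_add_one (h2 n).ne', norm_mul]
    have := h1 n
    have := h2G n
    have := (h2 n).ne'
    field_simp
    ring

theorem eval_zero_orthonormalPoly_zero_zero {n : ℕ} (hn : 1 ≤ n) :
    (orthonormalPoly 0 0 n).eval 0 = 0 := by
  rw [eval_zero_orthonormalPoly (by norm_num)]
  have : expB 0 0 = 0 := by simp [expB]
  rw [this, ascPochhammer_ne_zero_eval_zero _ (by omega), zero_div, mul_zero]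

/-! ### The reversed polynomial and the integrals `I_n` and `J_n`. -/

theorem coeff_starPoly (n : ℕ) (p : ℂ[X]) : (starPoly n p).coeff n = conj (p.coeff 0) := by
  simp only [starPoly, finsetSum_coeff, coeff_C_mul, coeff_X_pow]
  rw [Finset.sum_range_succ', Finset.sum_eq_zero fun j hj => ?_]
  · simp
  · rw [Finset.mem_range] at hj
    rw [if_neg (by omega), mul_zero]

theorem natDegree_starPoly_le (n : ℕ) (p : ℂ[X]) : (starPoly n p).natDegree ≤ n :=
  natDegree_sum_le_of_forall_le _ _ fun j _ =>
    (natDegree_C_mul_X_pow_le _ _).trans (Nat.sub_le n j)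

theorem circleIntegral_integrandI (hα : -1 / 2 < α) (β : ℝ) (n : ℕ) :
    (∮ ξ in C(0, 1), integrandI (weight α β) (orthonormalPoly α β) n ξ) =
      rRatio (orthonormalPoly α β) n := by
  simp only [integrandI, ← mul_div_assoc]
  rw [circleIntegral_eval_mul_conj_eval hα β (natDegree_starPoly_le n _), Finset.sum_range_succ,
    Finset.sum_eq_zero fun k hk => ?_]
  · rw [coeff_starPoly, Complex.conj_conj, momentFunctional_orthonormalPoly_self hα β, zero_add,
      rRatio, coeff_zero_eq_eval_zero, kCoeff_orthonormalPoly hα, ofReal_inv, div_inv_eq_mul]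
  · rw [momentFunctional_orthonormalPoly_eq_zero hα β (Finset.mem_range.1 hk), mul_zero]

theorem conj_eval_starPoly_circleMap (n : ℕ) (p : ℂ[X]) (θ : ℝ) :
    conj ((starPoly n p).eval (circleMap 0 1 θ)) =
      ∑ j ∈ Finset.range (n + 1), p.coeff j * circleMap 0 1 θ ^ ((j : ℤ) - n) := by
  rw [starPoly, eval_finsetSum, map_sum]
  refine Finset.sum_congr rfl fun j hj => ?_
  have h : ((n - j : ℕ) : ℤ) = n - j := by rw [Finset.mem_range] at hj; omega
  rw [eval_mul, eval_C, eval_pow, eval_X, map_mul, Complex.conj_conj, map_pow, conj_circleMap,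
    inv_pow, ← zpow_natCast, ← zpow_neg, h, neg_sub]

/-- The shift `m` serves two uses: `m = 0` for the integral in `dθ`, and `m = -1` for
`CircleIntegrable`, where the factor `1/ξ` is not cancelled by the derivative of the circle map. -/
theorem eval_mul_conj_eval_starPoly_mul_div (α β : ℝ) {n : ℕ} {p : ℂ[X]} (hp : p.natDegree ≤ n)
    (m : ℤ) (θ : ℝ) :
    p.eval (circleMap 0 1 θ) * conj ((starPoly n p).eval (circleMap 0 1 θ)) /
        (1 - circleMap 0 1 θ) * (circleMap 0 1 θ ^ m * weight α β (circleMap 0 1 θ)) =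
      ∑ j ∈ Finset.range (n + 1), ∑ i ∈ Finset.range (n + 1), p.coeff j * p.coeff i *
        (circleMap 0 1 θ ^ ((i : ℤ) - (n - j) + m) * weight α β (circleMap 0 1 θ) /
          (1 - circleMap 0 1 θ)) := by
  have h0 : circleMap 0 1 θ ≠ 0 := circleMap_ne_center one_ne_zero
  rw [conj_eval_starPoly_circleMap, eval_eq_sum_range' (Nat.lt_succ_of_le hp), Finset.sum_mul_sum,
    Finset.sum_comm, Finset.sum_div, Finset.sum_mul]
  refine Finset.sum_congr rfl fun j _ => ?_
  rw [Finset.sum_div, Finset.sum_mul]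
  refine Finset.sum_congr rfl fun i _ => ?_
  rw [show (i : ℤ) - (n - j) + m = i + (j - n) + m by ring, zpow_add₀ h0, zpow_add₀ h0,
    zpow_natCast]
  ring

theorem circleIntegrable_integrandJ (hα : 0 < α) (β : ℝ) (n : ℕ) :
    CircleIntegrable (integrandJ (weight α β) (orthonormalPoly α β) n) 0 1 := by
  have h : IntervalIntegrable (fun θ : ℝ => I⁻¹ * ((orthonormalPoly α β n).eval (circleMap 0 1 θ) *
      conj ((starPoly n (orthonormalPoly α β n)).eval (circleMap 0 1 θ)) /
        (1 - circleMap 0 1 θ) * (circleMap 0 1 θ ^ (-1 : ℤ) * weight α β (circleMap 0 1 θ))))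
      MeasureTheory.volume 0 (2 * Real.pi) := by
    simp only [eval_mul_conj_eval_starPoly_mul_div α β (natDegree_orthonormalPoly_le α β n)]
    exact (intervalIntegrable_fun_sum _ fun j _ => intervalIntegrable_fun_sum _ fun i _ =>
      (intervalIntegrable_zpow_mul_weight_div hα β _).const_mul _).const_mul _
  refine h.congr fun θ _ => ?_
  simp only [integrandJ, zpow_neg, zpow_one, div_eq_mul_inv, mul_inv]
  ring

/-- If `p` of degree at most `n` is orthogonal to `1, …, z^(n-1)`, the integral of
`(z d/dz + a) (z^(-n) p(z)^2)` against the weight with moments `M` only involves `p(0)`. -/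
theorem sum_coeff_mul_coeff_mul_moment {M : ℤ → ℂ} {n : ℕ} {p : ℂ[X]} (hp : p.natDegree ≤ n)
    (h0 : ∀ k < n, momentFunctional M k p = 0) (a : ℂ) :
    ∑ j ∈ Finset.range (n + 1), ∑ i ∈ Finset.range (n + 1), p.coeff j * p.coeff i *
        ((((i : ℤ) - (n - j) : ℤ) + a) * M ((i : ℤ) - (n - j))) =
      (a - n) * p.coeff 0 * momentFunctional M n p := by
  -- The exponent plus `a` is `j + i + (a - n)`. The inner sum is the pairing with `z^{n-j}`,
  -- nonzero at most for `j = 0`, so the part weighted by `j` vanishes; the part weighted by `i`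
  -- does so by symmetry.
  have hT : ∀ j ∈ Finset.range (n + 1), ∑ i ∈ Finset.range (n + 1),
      p.coeff i * M ((i : ℤ) - (n - j)) = if j = 0 then momentFunctional M n p else 0 := by
    intro j hj
    have h : ((n - j : ℕ) : ℤ) = n - j := by rw [Finset.mem_range] at hj; omega
    rw [← momentFunctional_eq_sum M _ hp]
    split_ifs with h1
    · simp [h1]
    · rw [← h, h0 _ (by rw [Finset.mem_range] at hj; omega)]
  have hJ : ∑ j ∈ Finset.range (n + 1), ∑ i ∈ Finset.range (n + 1),
      (j : ℂ) * p.coeff j * (p.coeff i * M ((i : ℤ) - (n - j))) = 0 := by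
    refine Finset.sum_eq_zero fun j hj => ?_
    rw [← Finset.mul_sum, hT j hj]
    split_ifs with h1
    · simp [h1]
    · rw [mul_zero]
  have hI : ∑ j ∈ Finset.range (n + 1), ∑ i ∈ Finset.range (n + 1),
      (i : ℂ) * p.coeff i * (p.coeff j * M ((i : ℤ) - (n - j))) = 0 := by
    rw [Finset.sum_comm, ← hJ]
    refine Finset.sum_congr rfl fun j _ => Finset.sum_congr rfl fun i _ => ?_
    rw [show (j : ℤ) - (n - i) = i - (n - j) by ring]
  have hK : ∑ j ∈ Finset.range (n + 1), ∑ i ∈ Finset.range (n + 1),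
      p.coeff j * (p.coeff i * M ((i : ℤ) - (n - j))) = p.coeff 0 * momentFunctional M n p := by
    rw [Finset.sum_congr rfl fun j hj => by rw [← Finset.mul_sum, hT j hj]]
    simp
  rw [mul_assoc, ← hK, Finset.mul_sum]
  refine Eq.trans ?_ (add_zero _)
  rw [← hI]
  refine Eq.trans ?_ (add_zero _)
  rw [← hJ, ← Finset.sum_add_distrib, ← Finset.sum_add_distrib]
  refine Finset.sum_congr rfl fun j _ => ?_
  rw [Finset.mul_sum, ← Finset.sum_add_distrib, ← Finset.sum_add_distrib]
  refine Finset.sum_congr rfl fun i _ => ?_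
  push_cast
  ring

theorem circleIntegral_integrandJ (hα : 0 < α) (β : ℝ) (n : ℕ) :
    (∮ ξ in C(0, 1), integrandJ (weight α β) (orthonormalPoly α β) n ξ) =
      (expA α β - n) * rRatio (orthonormalPoly α β) n / (2 * (α : ℂ)) := by
  have hα' : -1 / 2 < α := by linarith
  have h2 : 2 * (α : ℂ) ≠ 0 := by exact_mod_cast (by positivity : 2 * α ≠ 0)
  have hi := intervalIntegrable_zpow_mul_weight_div hα β
  simp only [integrandJ, ← mul_div_assoc]
  rw [circleIntegral_div_I_mul, eq_div_iff h2, mul_comm _ (2 * (α : ℂ))]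
  have h := eval_mul_conj_eval_starPoly_mul_div α β (natDegree_orthonormalPoly_le α β n) 0
  simp only [zpow_zero, one_mul, add_zero] at h
  simp only [h]
  rw [intervalIntegral.integral_finsetSum
    fun j _ => intervalIntegrable_fun_sum _ fun i _ => (hi _).const_mul _]
  simp only [intervalIntegral.integral_finsetSum fun i _ => (hi _).const_mul _,
    intervalIntegral.integral_const_mul, Finset.mul_sum, mul_left_comm (2 * (α : ℂ)),
    integral_zpow_mul_weight_div hα]
  rw [sum_coeff_mul_coeff_mul_moment (natDegree_orthonormalPoly_le α β n)
    fun k hk => momentFunctional_orthonormalPoly_eq_zero hα' β hk,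
    momentFunctional_orthonormalPoly_self hα', rRatio, coeff_zero_eq_eval_zero,
    kCoeff_orthonormalPoly hα', ofReal_inv, div_inv_eq_mul, mul_assoc]

end Values

end FisherHartwig

end

theorem mainTheorem2 (α β : ℝ) (hα : -1 / 2 < α) :
    -- the weight is integrable and normalised, and has exactly one orthonormal system
    CircleIntegrable (FisherHartwig.weight α β) 0 1 ∧
    FisherHartwig.symbolCoeff (FisherHartwig.weight α β) 0 = 1 / (2 * (Real.pi : ℂ)) ∧
    (∃! φ : ℕ → Polynomial ℂ,
      FisherHartwig.IsOrthonormalSystem (FisherHartwig.weight α β) φ) ∧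
    ∀ φ : ℕ → Polynomial ℂ,
      FisherHartwig.IsOrthonormalSystem (FisherHartwig.weight α β) φ →
      -- initial conditions
      FisherHartwig.kCoeff φ (-1) = 0 ∧ FisherHartwig.kCoeff φ 0 = 1 ∧
      -- the difference equation
      (∀ n : ℕ,
        2 * (α : ℂ) + 2 * (n : ℂ) + 1 =
          (FisherHartwig.mRatio φ n : ℂ) ^ 2 *
              (FisherHartwig.expA α β + n + 1) * (FisherHartwig.expB α β + n + 1) -
            (FisherHartwig.mRatio φ ((n : ℤ) - 1) : ℂ) ^ 2 *
              (FisherHartwig.expA α β + n) * (FisherHartwig.expB α β + n)) ∧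
      -- its solution
      (∀ n : ℕ,
        (FisherHartwig.mRatio φ n : ℂ) ^ 2 =
          ((n : ℂ) + 1) * (2 * (α : ℂ) + n + 1) /
            ((FisherHartwig.expA α β + n + 1) * (FisherHartwig.expB α β + n + 1))) ∧
      -- closed form of the leading coefficients
      (∀ n : ℕ,
        (FisherHartwig.kCoeff φ n : ℂ) ^ 2 =
          Complex.Gamma (2 * (α : ℂ) + 1) /
              (Complex.Gamma (FisherHartwig.expB α β + 1) *
                Complex.Gamma (FisherHartwig.expA α β + 1)) *
            (Complex.Gamma (FisherHartwig.expA α β + n + 1) / Complex.Gamma ((n : ℂ) + 1)) *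
            (Complex.Gamma (FisherHartwig.expB α β + n + 1) /
              Complex.Gamma ((n : ℂ) + 2 * (α : ℂ) + 1))) ∧
      -- closed form of `|φ_n(0)|^2`; for `α = β = 0` the factor `1 / Γ(α + iβ)` vanishes
      (∀ n : ℕ, (α ≠ 0 ∨ β ≠ 0) →
        ‖(φ n).eval 0‖ ^ 2 =
          Real.Gamma (2 * α + 1) / (Real.Gamma ((n : ℝ) + 1) * Real.Gamma ((n : ℝ) + 2 * α + 1)) *
            (‖Complex.Gamma (FisherHartwig.expA α β + n)‖ ^ 2 /
              ‖Complex.Gamma (FisherHartwig.expA α β)‖ ^ 2)) ∧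
      (∀ n : ℕ, 1 ≤ n → α = 0 → β = 0 → (φ n).eval 0 = 0) ∧
      -- closed form of the second coefficients
      (∀ n : ℕ, 1 ≤ n →
        FisherHartwig.lCoeff φ n =
          FisherHartwig.expB α β * n / ((n : ℂ) + FisherHartwig.expA α β) *
            (FisherHartwig.kCoeff φ n : ℂ)) ∧
      -- the recursion for `r_n`
      (∀ n : ℕ,
        (FisherHartwig.expA α β + n + 1) * FisherHartwig.rRatio φ (n + 1) =
          ((n : ℂ) + FisherHartwig.expB α β) * FisherHartwig.rRatio φ n) ∧
      (∀ n : ℕ, (α ≠ 0 ∨ β ≠ 0) →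
        FisherHartwig.rRatio φ n ≠ 0 ∧
        FisherHartwig.rRatio φ (n + 1) / FisherHartwig.rRatio φ n =
          ((n : ℂ) + FisherHartwig.expB α β) / (FisherHartwig.expA α β + n + 1)) ∧
      -- the integrals `I_n` and, where the integrand is integrable, `J_n`
      (∀ n : ℕ,
        (∮ ξ in C(0, 1), FisherHartwig.integrandI (FisherHartwig.weight α β) φ n ξ) =
          FisherHartwig.rRatio φ n) ∧
      (∀ n : ℕ, 0 < α →
        CircleIntegrable
          (FisherHartwig.integrandJ (FisherHartwig.weight α β) φ n) 0 1 ∧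
        (∮ ξ in C(0, 1), FisherHartwig.integrandJ (FisherHartwig.weight α β) φ n ξ) =
          (FisherHartwig.expA α β - n) * FisherHartwig.rRatio φ n / (2 * (α : ℂ))) := by
  refine ⟨FisherHartwig.circleIntegrable_weight hα β, FisherHartwig.symbolCoeff_weight_zero hα β,
    ⟨_, FisherHartwig.isOrthonormalSystem_orthonormalPoly hα β,
      fun φ hφ => hφ.eq_orthonormalPoly hα⟩, fun φ hφ => ?_⟩
  obtain rfl := hφ.eq_orthonormalPoly hα
  refine ⟨rfl, FisherHartwig.kCoeff_orthonormalPoly_zero hα β,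
    FisherHartwig.mRatio_difference_equation hα β, FisherHartwig.mRatio_orthonormalPoly_sq hα β,
    FisherHartwig.kCoeff_orthonormalPoly_sq_eq_Gamma hα β,
    fun n h => FisherHartwig.norm_sq_eval_zero_orthonormalPoly hα h n, ?_,
    fun n hn => FisherHartwig.lCoeff_orthonormalPoly hα β hn,
    FisherHartwig.rRatio_orthonormalPoly_succ hα β, fun n h => ?_,
    FisherHartwig.circleIntegral_integrandI hα β,
    fun n h => ⟨FisherHartwig.circleIntegrable_integrandJ h β n,
      FisherHartwig.circleIntegral_integrandJ h β n⟩⟩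
  · rintro n hn rfl rfl
    exact FisherHartwig.eval_zero_orthonormalPoly_zero_zero hn
  · have h0 := FisherHartwig.rRatio_orthonormalPoly_ne_zero hα h n
    refine ⟨h0, ?_⟩
    rw [div_eq_div_iff h0 (left_ne_zero_of_mul (FisherHartwig.expA_mul_expB_ne_zero hα β n)),
      mul_comm, FisherHartwig.rRatio_orthonormalPoly_succ hα β n]
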